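/- **Setting.** In a network of $L$ links, link $\ell$ contends in a slot with probability $p_\ell$, and $p_s=\sum_\ell p_\ell\prod_{i\ne\ell}(1-p_i)>0$. Slots have duration $\tau\in(0,1)$, a data transmission has duration $T=1$. Probing rounds $n=1,2,\dots$ are i.i.d. In round $n$ the contention takes $K_n\sim\mathrm{Geom}(p_s)$ slots; independently of it, the successful link has first-level rate $R^{(1)}_n=\rho W\sigma_M|\hat h_n|^2$, and a second-level probing (of duration $\tau$) would give the rate $R^{(2)}_n=\rho W\sigma_{2M}|\hat h_n+h_{e,n}|^2$, where $\hat h_n\sim\mathcal{CN}\bigl(0,\frac{\rho M}{\rho M+1}\bigr)$ and $h_{e,n}\sim\mathcal{CN}(0,\sigma_e^2)$ are independent, $\sigma_e^2=\frac{\rho M}{(\rho M+1)(2\rho M+1)}$, with $\rho,W>0$, integer $M\ge1$, and back-off factors $\sigma_M,\sigma_{2M}\in(0,1)$. Put $c_r=\sigma_{2M}/\sigma_M$ and $R_e=\sigma_{2M}W\rho\,\sigma_e^2$. After observing $R^{(1)}_n$ the link, using the observations made so far, either transmits at rate $R^{(1)}_n$ for time $1$, or gives up (a new round follows), or performs the second-level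 probing and, after observing $R^{(2)}_n$, either transmits at rate $R^{(2)}_n$ for time $1-\tau$ or gives up. If $N$ is the round in which the transmission takes place, $R_N$ and $T_{d,N}$ are its rate and duration, and $T_N$ is the total time spent (contention, all second-level probings performed, transmission). The throughput of a strategy is $E[R_NT_{d,N}]/E[T_N]$, and $\theta^*$ is the supremum of the throughput over all strategies with $N<\infty$ a.s. and $E[T_N]<\infty$. A strategy is optimal if it is one of these and attains $\theta^*$. Let $F$ be the distribution of $R^{(1)}_n$, let $G(\cdot\mid x)$ be the conditional cdf of $R^{(2)}_n$ given $R^{(1)}_n=x$ (the cdf of $|\sqrt{c_rx}+z|^2$ with $z\sim\mathcal{CN}(0,R_e)$), and let $$J_\theta(x,r)=r\,G\Bigl(\tfrac r{1-\tau}+\theta\Bigm|x\Bigr)+(1-\tau)\int_{\frac r{1-\tau}+\theta}^\infty(y-\theta)\,G(dy\mid x)-\theta\tau .$$ Let $(x_J,x_q,\theta_A^*)$, with $x_J,x_q\ge0$, denote a solution $(x_J,x_q,\theta)$ of the system $$\int_\theta^\infty(1-G(u|x_J))\,du=\frac{\theta\tau}{1-\tau},\qquad (c_r(1-\tau)-1)x_q+(1-\tau)\Bigl(R_e+\int_0^\theta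 G(u|x_q)\,du\Bigr)=0,$$ $$\int_{x_J}^{x_q}J_\theta(u,0)\,dF(u)+\int_{x_q}^\infty(u-\theta)\,dF(u)=\frac{\theta\tau}{p_s}$$ (with $\int_{x_J}^{x_q}=-\int_{x_q}^{x_J}$ if $x_q<x_J$), and let $\theta_B^*$ denote the solution of $E[(R^{(1)}-\theta)^+]=\theta\tau/p_s$. **Strategy A:** in each round, give up if $R^{(1)}_n<x_J$; perform the second-level probing if $x_J\le R^{(1)}_n\le x_q$, and then transmit if $R^{(2)}_n>\theta_A^*$ and give up otherwise; transmit immediately if $R^{(1)}_n\ge x_J$ and $R^{(1)}_n>x_q$. **Strategy B:** in each round, transmit if $R^{(1)}_n>\theta_B^*$ and give up otherwise; never perform the second-level probing. **Theorem 2.** The number $\theta_B^*$ exists and is unique. If $c_r<\frac1{1-\tau}$ and $\frac{R_e}{\theta^*}e^{-\theta^*/R_e}<\frac\tau{1-\tau}$, then the solution $(x_J,x_q,\theta_A^*)$ exists and is unique. Whenever $(x_J,x_q,\theta_A^*)$ is a solution, $x_J\le x_q$ holds if and only if $J_{\theta_A^*}(\theta_A^*,0)\ge0$; Strategy A is optimal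 if and only if $J_{\theta_A^*}(\theta_A^*,0)\ge0$; and if $J_{\theta_A^*}(\theta_A^*,0)<0$, then Strategy B is optimal. -/

import Mathlib

open MeasureTheory ProbabilityTheory

namespace DOS

/-- Probability that exactly one of the `L` links contends in a slot, when link `ℓ` contends with
probability `p ℓ`, independently of the others. -/
noncomputable def contentionProb {L : ℕ} (p : Fin L → ℝ) : ℝ :=
  ∑ ℓ, p ℓ * ∏ i ∈ Finset.univ.erase ℓ, (1 - p i)

/-- Parameters of the network. The duration of a data transmission is normalized to `1`. -/
structure Params where
  /-- number of links -/
  L : ℕ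
  /-- contention probabilities of the links -/
  p : Fin L → ℝ
  /-- normalized receiver SNR -/
  ρ : ℝ
  /-- bandwidth -/
  W : ℝ
  /-- training length of one level of probing -/
  M : ℕ
  /-- rate back-off factor after the first-level probing -/
  σ₁ : ℝ
  /-- rate back-off factor after the second-level probing -/
  σ₂ : ℝ
  /-- slot duration, which is also the duration of the second-level probing -/
  τ : ℝ
  p_mem : ∀ ℓ, p ℓ ∈ Set.Icc (0 : ℝ) 1
  contentionProb_pos : 0 < contentionProb p
  ρ_pos : 0 < ρ
  W_pos : 0 < W
  M_pos : 0 < M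
  σ₁_mem : σ₁ ∈ Set.Ioo (0 : ℝ) 1
  σ₂_mem : σ₂ ∈ Set.Ioo (0 : ℝ) 1
  τ_mem : τ ∈ Set.Ioo (0 : ℝ) 1

/-- The circularly symmetric complex normal law `CN(0, v)`: real and imaginary parts are
independent and `N(0, v/2)`. -/
noncomputable def complexNormal (v : ℝ) : Measure ℂ :=
  ((gaussianReal 0 (v / 2).toNNReal).prod (gaussianReal 0 (v / 2).toNNReal)).map
    (fun q : ℝ × ℝ => (⟨q.1, q.2⟩ : ℂ))

/-- The geometric law on `{1, 2, …}` with success probability `s`. -/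
noncomputable def geometricLaw (s : ℝ) : Measure ℕ :=
  Measure.sum fun k : ℕ => ENNReal.ofReal ((1 - s) ^ k * s) • Measure.dirac (k + 1)

namespace Params

variable (P : Params)

/-- Probability `p_s` of a successful contention in a slot. -/
noncomputable def ps : ℝ := contentionProb P.p

/-- Variance of the first-level MMSE channel estimate. -/
noncomputable def varEst : ℝ := P.ρ * P.M / (P.ρ * P.M + 1)

/-- Variance `σ_e²` of the increment between the first- and second-level channel estimates. -/
noncomputable def varInc : ℝ := P.M * P.ρ / ((P.M * P.ρ + 1) * (2 * P.M * P.ρ + 1))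

/-- `c_r`, the coefficient in `E[R⁽²⁾ | R⁽¹⁾] = c_r R⁽¹⁾ + R_e`. -/
noncomputable def cr : ℝ := P.σ₂ / P.σ₁

/-- `R_e`, the expected relative rate gain due to the second-level probing. -/
noncomputable def Re : ℝ := P.σ₂ * P.W * P.ρ * P.varInc

/-- Rate supported after the first-level probing, given the channel estimate `h`. -/
noncomputable def rate₁ (h : ℂ) : ℝ := P.ρ * P.W * P.σ₁ * ‖h‖ ^ 2

/-- Rate supported after the second-level probing, given the refined channel estimate `h`. -/
noncomputable def rate₂ (h : ℂ) : ℝ := P.ρ * P.W * P.σ₂ * ‖h‖ ^ 2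

/-- The law `dF` of the first-level rate `R⁽¹⁾` (an exponential law). -/
noncomputable def F : Measure ℝ := (complexNormal P.varEst).map P.rate₁

/-- The conditional law of `R⁽²⁾` given `R⁽¹⁾ = x`, for `x ≥ 0`: the law of `|√(c_r x) + z|²` with
`z ∼ CN(0, R_e)`, a noncentral `χ²` law with two degrees of freedom. -/
noncomputable def condLaw (x : ℝ) : Measure ℝ :=
  (complexNormal P.Re).map (fun z : ℂ => ‖((Real.sqrt (P.cr * x) : ℝ) : ℂ) + z‖ ^ 2)

/-- The conditional cdf `G(y | x)` of `R⁽²⁾` given `R⁽¹⁾ = x`. -/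
noncomputable def G (y x : ℝ) : ℝ := (P.condLaw x).real (Set.Iic y)

/-- `J_θ(x, r)`: expected net reward of performing the second-level probing after observing
`R⁽¹⁾ = x`, when `θ` is the cost per unit of time and re-contending is worth `r`. -/
noncomputable def J (θ x r : ℝ) : ℝ :=
  r * P.G (r / (1 - P.τ) + θ) x
    + (1 - P.τ) * (∫ y in Set.Ioi (r / (1 - P.τ) + θ), (y - θ) ∂(P.condLaw x)) - θ * P.τ

/-- `(xJ, xq, θ)`, with nonnegative rates `xJ`, `xq`, solves the system of equations that
determines the two thresholds of Strategy A and `θ_A*`. The first integral of the last equation is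
oriented. -/
structure SolvesA (xJ xq θ : ℝ) : Prop where
  xJ_nonneg : 0 ≤ xJ
  xq_nonneg : 0 ≤ xq
  eq_J : ∫ u in Set.Ioi θ, (1 - P.G u xJ) = θ * P.τ / (1 - P.τ)
  eq_q : (P.cr * (1 - P.τ) - 1) * xq
    + (1 - P.τ) * (P.Re + ∫ u in (0 : ℝ)..θ, P.G u xq) = 0
  eq_θ : (∫ u in xJ..xq, P.J θ u 0 ∂P.F) + (∫ u in Set.Ioi xq, (u - θ) ∂P.F)
    = θ * P.τ / P.ps

/-- `θ` solves the equation `E[R⁽¹⁾ - θ]⁺ = θ τ / p_s` that determines `θ_B*`. -/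
def SolvesB (θ : ℝ) : Prop :=
  ∫ u, max (u - θ) 0 ∂P.F = θ * P.τ / P.ps

end Params

/-- The random inputs of the successive probing rounds: in round `n` (rounds are numbered from `0`)
there are `K n` slots of contention, the successful link has first-level channel estimate `h n`, and
a second-level probing would refine it to `h n + e n`. Rounds are i.i.d., and the three inputs of a
round are independent. -/
structure ProbingModel (P : Params) {Ω : Type*} [MeasurableSpace Ω] (μ : Measure Ω) where
  K : ℕ → Ω → ℕ
  h : ℕ → Ω → ℂ
  e : ℕ → Ω → ℂ
  measurable_K : ∀ n, Measurable (K n)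
  measurable_h : ∀ n, Measurable (h n)
  measurable_e : ∀ n, Measurable (e n)
  law : ∀ n, μ.map (fun ω => (K n ω, h n ω, e n ω)) =
    (geometricLaw P.ps).prod ((complexNormal P.varEst).prod (complexNormal P.varInc))
  indep : iIndepFun (fun n ω => (K n ω, h n ω, e n ω)) μ

namespace ProbingModel

variable {P : Params} {Ω : Type*} [MeasurableSpace Ω] {μ : Measure Ω} (X : ProbingModel P μ)

/-- First-level rate `R⁽¹⁾` of round `n`. -/
noncomputable def R₁ (n : ℕ) (ω : Ω) : ℝ := P.rate₁ (X.h n ω)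

/-- Second-level rate `R⁽²⁾` of round `n`. -/
noncomputable def R₂ (n : ℕ) (ω : Ω) : ℝ := P.rate₂ (X.h n ω + X.e n ω)

/-- The outcome of the second-level probing of round `n`: it is `R⁽²⁾` if that probing is performed
(`φ n = 2`), and nothing (encoded as `0`) otherwise. -/
noncomputable def outcome₂ (φ : ℕ → Ω → Fin 3) (n : ℕ) (ω : Ω) : ℝ :=
  if φ n ω = 2 then X.R₂ n ω else 0

/-- Information available when `φ n` is chosen: contention times and first-level rates up to round
`n`, outcomes of the second-level probings that were performed in earlier rounds. -/
noncomputable abbrev info₁ (φ : ℕ → Ω → Fin 3) (n : ℕ) : MeasurableSpace Ω :=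
  (⨆ j ∈ Set.Iic n, MeasurableSpace.comap (X.K j) inferInstance
      ⊔ MeasurableSpace.comap (X.R₁ j) inferInstance)
    ⊔ ⨆ j ∈ Set.Iio n, MeasurableSpace.comap (X.outcome₂ φ j) inferInstance

/-- Information available when `ψ n` is chosen. -/
noncomputable abbrev info₂ (φ : ℕ → Ω → Fin 3) (n : ℕ) : MeasurableSpace Ω :=
  X.info₁ φ n ⊔ MeasurableSpace.comap (X.outcome₂ φ n) inferInstance

/-- A scheduling strategy, which bases its decisions on the information available so far.
`φ n = 1`: transmit at the first-level rate; `φ n = 0`: give up and re-contend;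
`φ n = 2`: perform the second-level probing, then transmit at the refined rate if `ψ n = true` and
give up and re-contend if `ψ n = false`. -/
structure Strategy where
  φ : ℕ → Ω → Fin 3
  ψ : ℕ → Ω → Bool
  measurable_φ : ∀ n, Measurable[X.info₁ φ n] (φ n)
  measurable_ψ : ∀ n, Measurable[X.info₂ φ n] (ψ n)

namespace Strategy

variable {X} (s : X.Strategy)

/-- The strategy transmits in round `n`. -/
def Transmits (n : ℕ) (ω : Ω) : Prop :=
  s.φ n ω = 1 ∨ (s.φ n ω = 2 ∧ s.ψ n ω = true)

/-- The stopping rule: the first round in which the strategy transmits (irrelevant value `0` if there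
is none). -/
noncomputable def stopRound (ω : Ω) : ℕ := sInf {n | s.Transmits n ω}

/-- Transmission rate in round `n`. -/
noncomputable def rate (n : ℕ) (ω : Ω) : ℝ :=
  if s.φ n ω = 1 then X.R₁ n ω
  else if s.φ n ω = 2 ∧ s.ψ n ω = true then X.R₂ n ω
  else 0

/-- Duration of the data transmission when stopping in round `n`. -/
noncomputable def dataTime (n : ℕ) (ω : Ω) : ℝ :=
  if s.φ n ω = 2 ∧ s.ψ n ω = true then 1 - P.τ else 1

/-- Total time when stopping in round `n`: contention, second-level probings when performed, and
data transmission. -/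
noncomputable def totalTime (n : ℕ) (ω : Ω) : ℝ :=
  (∑ j ∈ Finset.range (n + 1), ((X.K j ω : ℝ) * P.τ + if s.φ j ω = 2 then P.τ else 0))
    + s.dataTime n ω

/-- Expected amount of transmitted data, `E[R_N T_{d,N}]`. -/
noncomputable def expectedReward : ENNReal :=
  ∫⁻ ω, ENNReal.ofReal (s.rate (s.stopRound ω) ω * s.dataTime (s.stopRound ω) ω) ∂μ

/-- Expected total time, `E[T_N]`. -/
noncomputable def expectedTime : ENNReal :=
  ∫⁻ ω, ENNReal.ofReal (s.totalTime (s.stopRound ω) ω) ∂μ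

/-- The stopping rule belongs to the class `Q`: it is almost surely finite and `E[T_N] < ∞`. -/
def Admissible : Prop :=
  (∀ᵐ ω ∂μ, ∃ n, s.Transmits n ω) ∧ s.expectedTime < ⊤

/-- The rate of return `E[R_N T_{d,N}] / E[T_N]`. -/
noncomputable def throughput : ENNReal := s.expectedReward / s.expectedTime

end Strategy

/-- The optimal throughput `θ*`. -/
noncomputable def optimalThroughput : ENNReal :=
  ⨆ (s : X.Strategy) (_ : s.Admissible), s.throughput

/-- A strategy is optimal if it is admissible and attains the optimal throughput. -/
def Strategy.IsOptimal {X : ProbingModel P μ} (s : X.Strategy) : Prop :=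
  s.Admissible ∧ s.throughput = X.optimalThroughput

/-- The strategy that in every round applies `f` to the first-level rate, and `g` to the outcome of
the second-level probing if that is performed. -/
noncomputable def stationary (f : ℝ → Fin 3) (hf : Measurable f) (g : ℝ → Bool)
    (hg : Measurable g) : X.Strategy where
  φ n ω := f (X.R₁ n ω)
  ψ n ω := g (X.outcome₂ (fun n ω => f (X.R₁ n ω)) n ω)
  measurable_φ n := by
    have h1 : Measurable[MeasurableSpace.comap (X.R₁ n) inferInstance] (X.R₁ n) :=
      comap_measurable _
    refine (hf.comp h1).mono ?_ le_rfl
    refine le_trans ?_ le_sup_left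
    exact le_trans le_sup_right
      (le_iSup₂_of_le (f := fun j (_ : j ∈ Set.Iic n) =>
        MeasurableSpace.comap (X.K j) inferInstance
          ⊔ MeasurableSpace.comap (X.R₁ j) inferInstance) n (Set.mem_Iic.2 le_rfl) le_rfl)
  measurable_ψ n :=
    (hg.comp (comap_measurable (X.outcome₂ (fun n ω => f (X.R₁ n ω)) n))).mono le_sup_right le_rfl

/-- Strategy A: give up if `R⁽¹⁾ < xJ`, transmit if `R⁽¹⁾ > xq`, and perform the second-level probing
if `R⁽¹⁾ ∈ [xJ, xq]`, after which transmit exactly if `R⁽²⁾ > θ`. -/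
noncomputable def strategyA (xJ xq θ : ℝ) : X.Strategy :=
  X.stationary (fun x => if x < xJ then 0 else if x ≤ xq then 2 else 1)
    (Measurable.ite measurableSet_Iio measurable_const
      (Measurable.ite measurableSet_Iic measurable_const measurable_const))
    (fun y => if θ < y then true else false)
    (Measurable.ite measurableSet_Ioi measurable_const measurable_const)

/-- Strategy B: transmit if `R⁽¹⁾ > θ`, give up otherwise; never perform the second-level probing. -/
noncomputable def strategyB (θ : ℝ) : X.Strategy :=
  X.stationary (fun x => if θ < x then 1 else 0)
    (Measurable.ite measurableSet_Ioi measurable_const measurable_const)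
    (fun _ => false) measurable_const

end ProbingModel

end DOS

/-! The ratio `E[R T_d] / E[T]` is handled by charging a price `θ` per unit of time. At the right
price re-contending is worth nothing, so after seeing `R⁽¹⁾ = u` the best expected net gain of a
round is `P.gain θ u`, the maximum of `u - θ` (transmit), `J_θ(u, 0)` (probe) and `0` (give up),
against an expected contention cost `θ τ / p_s`. The expected gain decreases in `θ` while the cost
increases strictly, so exactly one price is fair (`IsPriced.exists_eq`, `IsPriced.unique`).

The fair price is the optimal throughput. Reaching round `n` is decided by earlier rounds, hence
independent of round `n`; so at the fair price no strategy gains in any round, and summing over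
rounds gives the upper bound (`setIntegral_roundReward_le`, `throughput_le`). A stationary rule that
picks a maximizer in `gain` attains it, because its throughput is the ratio of one-round
expectations (`stationary_admissible_and_throughput`, `stationary_isOptimal`).

The threshold form comes from two monotonicities: `J_θ(·, 0)` increases strictly, and `u - θ -
J_θ(u, 0)` increases strictly when `c_r (1 - τ) < 1`. Both rest on the stochastic monotonicity of
noncentral `χ²` laws, proved by reflection in the line midway between two Gaussian centres
(`shiftDifference_nonneg`). Thus `x_J` is the zero of `J_θ(·, 0)`, `x_q` is its crossing with `u -
θ`, and the sign of `J_θ(θ, 0)` decides their order, because `u - θ` vanishes at `u = θ`.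

In natural order the third equation is the fair-price equation for `gain`, and Strategy A follows
the maximizer. In reversed order the oriented integral turns it into the equation for
`reversedGain`, whose solution is at least `θ_B*`. If `J_t(t, 0)` vanished at some price `t` between
`θ_B*` and that solution, the expected direct and reversed gains would agree at `t`, forcing the
three prices to coincide (`eq_of_mem_Icc_J_zero_self`). So a negative sign at `θ_A*` gives a
nonpositive sign at `θ_B*`; there probing never helps and B is optimal, while A, which now never
probes, rejects profitable rates in `(θ_B*, x_J)`. The same fact yields uniqueness and, when the
fair price gives a negative sign, existence of the solution. -/

namespace DOS

/-! ### The complex normal law: density, symmetries, second moment. -/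

/-- The density of the circularly symmetric complex normal law. -/
noncomputable def complexNormalDensity (v : ℝ) (z : ℂ) : ℝ :=
  (Real.pi * v)⁻¹ * Real.exp (-‖z‖ ^ 2 / v)

lemma complexNormalDensity_pos {v : ℝ} (hv : 0 < v) (z : ℂ) : 0 < complexNormalDensity v z := by
  unfold complexNormalDensity; have := Real.pi_pos; positivity

lemma continuous_complexNormalDensity (v : ℝ) : Continuous (complexNormalDensity v) := by
  unfold complexNormalDensity; fun_prop

lemma measurable_complex_mk : Measurable (fun q : ℝ × ℝ => (⟨q.1, q.2⟩ : ℂ)) :=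
  Complex.measurableEquivRealProd.symm.measurable

instance isProbabilityMeasure_complexNormal (v : ℝ) : IsProbabilityMeasure (complexNormal v) :=
  Measure.isProbabilityMeasure_map measurable_complex_mk.aemeasurable

/-- The product of the two real Gaussian densities depends on the norm only. Isometry invariance,
the reflection argument and polar coordinates all start from this form. -/
lemma complexNormal_eq_withDensity {v : ℝ} (hv : 0 < v) :
    complexNormal v
      = (volume : Measure ℂ).withDensity (fun z => ENNReal.ofReal (complexNormalDensity v z)) := by
  have hv' : (v / 2).toNNReal ≠ 0 := by simpa using hv
  have hm : Measurable (fun z => ENNReal.ofReal (complexNormalDensity v z)) :=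
    (continuous_complexNormalDensity v).measurable.ennreal_ofReal
  refine Measure.ext_of_lintegral _ fun f hf => ?_
  rw [complexNormal, lintegral_map hf measurable_complex_mk]
  change ∫⁻ q, (f ∘ fun q : ℝ × ℝ => (⟨q.1, q.2⟩ : ℂ)) q ∂_ = _
  rw [gaussianReal_of_var_ne_zero _ hv', prod_withDensity (measurable_gaussianPDF _ _)
      (measurable_gaussianPDF _ _), lintegral_withDensity_eq_lintegral_mul _ (by fun_prop)
      (hf.comp measurable_complex_mk), lintegral_withDensity_eq_lintegral_mul _ hm hf,
    ← (Complex.volume_preserving_equiv_real_prod.symm).lintegral_comp (hm.mul hf)]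
  refine lintegral_congr fun q => ?_
  simp only [Pi.mul_apply, Function.comp_apply]
  congr 1
  rw [gaussianPDF, gaussianPDF, ← ENNReal.ofReal_mul (gaussianPDFReal_nonneg _ _ _)]
  congr 1
  have h2 : ‖(Complex.measurableEquivRealProd.symm q)‖ ^ 2 = q.1 ^ 2 + q.2 ^ 2 := by
    rw [← Complex.normSq_eq_norm_sq, Complex.normSq_apply]
    simp [sq]
  rw [complexNormalDensity, h2, gaussianPDFReal, gaussianPDFReal]
  simp only [sub_zero, Real.coe_toNNReal _ (half_pos hv).le]
  rw [mul_mul_mul_comm, ← Real.exp_add, ← mul_inv,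
    Real.mul_self_sqrt (by have := Real.pi_pos; positivity)]
  congr 2
  · ring
  · field_simp; ring

lemma integral_complexNormal {v : ℝ} (hv : 0 < v) (f : ℂ → ℝ) :
    ∫ z, f z ∂(complexNormal v) = ∫ z, complexNormalDensity v z * f z := by
  have hm := (continuous_complexNormalDensity v).measurable
  rw [complexNormal_eq_withDensity hv, integral_withDensity_eq_integral_toReal_smul
    hm.ennreal_ofReal (by simp)]
  simp [ENNReal.toReal_ofReal (complexNormalDensity_pos hv _).le]

lemma integrable_complexNormal_iff {v : ℝ} (hv : 0 < v) (f : ℂ → ℝ) :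
    Integrable f (complexNormal v) ↔ Integrable (fun z => complexNormalDensity v z * f z) := by
  have hm := (continuous_complexNormalDensity v).measurable
  rw [complexNormal_eq_withDensity hv, integrable_withDensity_iff_integrable_smul'
    hm.ennreal_ofReal (by simp)]
  simp [ENNReal.toReal_ofReal (complexNormalDensity_pos hv _).le]

lemma complexNormal_map_isometry {v : ℝ} (hv : 0 < v) (e : ℂ ≃ₗᵢ[ℝ] ℂ) :
    (complexNormal v).map e = complexNormal v := by
  have hm : Measurable (fun z => ENNReal.ofReal (complexNormalDensity v z)) :=
    (continuous_complexNormalDensity v).measurable.ennreal_ofReal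
  have he : Measurable e := e.continuous.measurable
  refine Measure.ext_of_lintegral _ fun f hf => ?_
  rw [lintegral_map hf he]
  change ∫⁻ q, (f ∘ e) q ∂_ = _
  rw [complexNormal_eq_withDensity hv,
    lintegral_withDensity_eq_lintegral_mul _ hm (hf.comp he),
    lintegral_withDensity_eq_lintegral_mul _ hm hf,
    ← e.measurePreserving.lintegral_comp (hm.mul hf)]
  refine lintegral_congr fun q => ?_
  simp [complexNormalDensity]

lemma complexNormal_map_mul (v : ℝ) {k : ℝ} :
    (complexNormal v).map (fun z => (k : ℂ) * z) = complexNormal (k ^ 2 * v) := by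
  have hk : Measurable (fun x : ℝ => k * x) := measurable_const_mul k
  have h2 : (k ^ 2 * v / 2).toNNReal = ⟨k ^ 2, sq_nonneg k⟩ * (v / 2).toNNReal := by
    rw [mul_div_assoc, Real.toNNReal_mul (sq_nonneg k)]
    congr 1
    ext; simp only [Real.coe_toNNReal', max_eq_left (sq_nonneg k)]; rfl
  rw [complexNormal, complexNormal, Measure.map_map (by fun_prop) measurable_complex_mk, h2]
  have := gaussianReal_map_const_mul (μ := 0) (v := (v / 2).toNNReal) k
  rw [mul_zero] at this
  erw [← this]
  rw [Measure.map_prod_map _ _ hk hk, Measure.map_map measurable_complex_mk (by fun_prop)]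
  congr 1
  ext q
  apply Complex.ext <;> simp

/-- Positivity of `v` matters: variance zero gives a point mass. Later this makes the first-level
rate charge every interval of positive rates. -/
instance isOpenPosMeasure_complexNormal_of_fact {v : ℝ} [hv : Fact (0 < v)] :
    (complexNormal v).IsOpenPosMeasure := by
  rw [complexNormal_eq_withDensity hv.out]
  refine Measure.IsOpenPosMeasure.mk fun U hU hne h0 => ?_
  rw [withDensity_apply_eq_zero (continuous_complexNormalDensity v).measurable.ennreal_ofReal] at h0
  refine (hU.measure_pos volume hne).ne' ?_
  convert h0
  ext z
  simp [complexNormalDensity_pos hv.out z]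

lemma norm_sq_ofReal_add (a : ℝ) (z : ℂ) : ‖(a : ℂ) + z‖ ^ 2 = (a + z.re) ^ 2 + z.im ^ 2 := by
  rw [← Complex.normSq_eq_norm_sq, Complex.normSq_apply]
  simp [sq]

lemma integrable_sq_gaussianReal (a : ℝ) (w : NNReal) :
    Integrable (fun x : ℝ => (a + x) ^ 2) (gaussianReal 0 w) := by
  have h := (memLp_const a).add (memLp_id_gaussianReal (μ := 0) (v := w) 2)
  exact h.integrable_sq

lemma integral_sq_gaussianReal (a : ℝ) (w : NNReal) :
    ∫ x : ℝ, (a + x) ^ 2 ∂(gaussianReal 0 w) = a ^ 2 + w := by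
  have hid : Integrable (fun x : ℝ => x) (gaussianReal 0 w) :=
    (memLp_id_gaussianReal (μ := 0) (v := w) 1).integrable le_rfl
  have hsq : Integrable (fun x : ℝ => x ^ 2) (gaussianReal 0 w) := by
    simpa using integrable_sq_gaussianReal 0 w
  have hv : ∫ x : ℝ, x ^ 2 ∂(gaussianReal 0 w) = w := by
    have h := variance_fun_id_gaussianReal (μ := 0) (v := w)
    rw [variance_of_integral_eq_zero (by fun_prop) integral_id_gaussianReal] at h
    exact h
  have : ∀ x : ℝ, (a + x) ^ 2 = a ^ 2 + (2 * a * x + x ^ 2) := fun x => by ring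
  simp_rw [this]
  have hsum : Integrable (fun x : ℝ => 2 * a * x + x ^ 2) (gaussianReal 0 w) :=
    (hid.const_mul _).add hsq
  rw [integral_add (integrable_const _) hsum, integral_add (hid.const_mul _) hsq, integral_const_mul, integral_id_gaussianReal, hv]
  simp

lemma integrable_norm_sq_complexNormal (v a : ℝ) :
    Integrable (fun z : ℂ => ‖(a : ℂ) + z‖ ^ 2) (complexNormal v) := by
  rw [complexNormal, integrable_map_measure (by fun_prop) measurable_complex_mk.aemeasurable]
  have h1 := (integrable_sq_gaussianReal a (v / 2).toNNReal).comp_fst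
    (gaussianReal 0 (v / 2).toNNReal)
  have h2 := (integrable_sq_gaussianReal 0 (v / 2).toNNReal).comp_snd
    (gaussianReal 0 (v / 2).toNNReal)
  refine (h1.add h2).congr (Filter.Eventually.of_forall fun q => ?_)
  simp [norm_sq_ofReal_add]

lemma integral_norm_sq_complexNormal {v : ℝ} (hv : 0 ≤ v) (a : ℝ) :
    ∫ z : ℂ, ‖(a : ℂ) + z‖ ^ 2 ∂(complexNormal v) = a ^ 2 + v := by
  rw [complexNormal, integral_map measurable_complex_mk.aemeasurable (by fun_prop)]
  have h1 := (integrable_sq_gaussianReal a (v / 2).toNNReal).comp_fst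
    (gaussianReal 0 (v / 2).toNNReal)
  have h2 := (integrable_sq_gaussianReal 0 (v / 2).toNNReal).comp_snd
    (gaussianReal 0 (v / 2).toNNReal)
  simp only [norm_sq_ofReal_add]
  have e2 := integral_sq_gaussianReal 0 (v / 2).toNNReal
  simp only [zero_add] at h2 e2
  rw [integral_add h1 h2]
  rw [integral_fun_fst (μ := gaussianReal 0 (v / 2).toNNReal) (f := fun x : ℝ => (a + x) ^ 2),
    integral_fun_snd (μ := gaussianReal 0 (v / 2).toNNReal) (f := fun x : ℝ => x ^ 2),
    integral_sq_gaussianReal, e2]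
  simp [Real.coe_toNNReal _ (div_nonneg hv zero_le_two)]
  ring

end DOS

/-! ### Noncentral `χ²` laws compared by reflection. -/

namespace DOS

/-- The reflection of the complex plane in the vertical line with real part `s / 2`. -/
noncomputable def verticalReflection (s : ℝ) (w : ℂ) : ℂ := (s : ℂ) - (starRingEnd ℂ) w

lemma measurePreserving_verticalReflection (s : ℝ) : MeasurePreserving (verticalReflection s) :=
  (Measure.measurePreserving_sub_left (volume : Measure ℂ) (s : ℂ)).comp
    Complex.conjLIE.measurePreserving

lemma measurableEmbedding_verticalReflection (s : ℝ) :
    MeasurableEmbedding (verticalReflection s) :=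
  ((MeasurableEquiv.subLeft (s : ℂ)).measurableEmbedding).comp
    Complex.conjLIE.toHomeomorph.measurableEmbedding

lemma integrable_shift_complexNormal {v : ℝ} (hv : 0 < v) {f : ℝ → ℝ} {a : ℝ}
    (ha : Integrable (fun z : ℂ => f (‖(a : ℂ) + z‖ ^ 2)) (complexNormal v)) :
    Integrable (fun w : ℂ => complexNormalDensity v (w - a) * f (‖w‖ ^ 2)) := by
  have h := ((integrable_complexNormal_iff hv _).1 ha).comp_sub_right (a : ℂ)
  simpa using h

lemma integral_shift_complexNormal {v : ℝ} (hv : 0 < v) (f : ℝ → ℝ) (a : ℝ) :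
    ∫ z : ℂ, f (‖(a : ℂ) + z‖ ^ 2) ∂(complexNormal v)
      = ∫ w : ℂ, complexNormalDensity v (w - a) * f (‖w‖ ^ 2) := by
  rw [integral_complexNormal hv,
    ← integral_sub_right_eq_self (fun z : ℂ => complexNormalDensity v z * f (‖(a : ℂ) + z‖ ^ 2))
      (a : ℂ)]
  simp

/-- The integrand that expresses the difference of two shifted Gaussian averages of a radial
function. -/
noncomputable def shiftDifference (v : ℝ) (f : ℝ → ℝ) (a b : ℝ) (w : ℂ) : ℝ :=
  (f (‖w‖ ^ 2) - f (‖verticalReflection (a + b) w‖ ^ 2))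
    * (complexNormalDensity v (w - b) - complexNormalDensity v (w - a))

lemma norm_sq_verticalReflection (s : ℝ) (w : ℂ) :
    ‖verticalReflection s w‖ ^ 2 = ‖w‖ ^ 2 + s * (s - 2 * w.re) := by
  rw [← Complex.normSq_eq_norm_sq, ← Complex.normSq_eq_norm_sq, Complex.normSq_apply,
    Complex.normSq_apply, verticalReflection]
  simp
  ring

lemma norm_sq_sub_ofReal (w : ℂ) (a : ℝ) : ‖w - a‖ ^ 2 = ‖w‖ ^ 2 + a * (a - 2 * w.re) := by
  rw [← Complex.normSq_eq_norm_sq, ← Complex.normSq_eq_norm_sq, Complex.normSq_apply,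
    Complex.normSq_apply]
  simp
  ring

lemma complexNormalDensity_le_iff {v : ℝ} (hv : 0 < v) (z w : ℂ) :
    complexNormalDensity v z ≤ complexNormalDensity v w ↔ ‖w‖ ^ 2 ≤ ‖z‖ ^ 2 := by
  unfold complexNormalDensity
  have := Real.pi_pos
  rw [mul_le_mul_iff_of_pos_left (by positivity), Real.exp_le_exp,
    div_le_div_iff_of_pos_right hv, neg_le_neg_iff]

/-- To the right of the mirror line, reflection does not increase the modulus (as `a + b ≥ 0`) and
`w` is at least as close to `b` as to `a`, so both factors are nonnegative; to the left both signs
flip. -/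
lemma shiftDifference_nonneg {v : ℝ} (hv : 0 < v) {f : ℝ → ℝ} (hf : Monotone f) {a b : ℝ}
    (ha : 0 ≤ a) (hab : a ≤ b) (w : ℂ) : 0 ≤ shiftDifference v f a b w := by
  unfold shiftDifference
  rcases le_total (a + b) (2 * w.re) with h | h
  · refine mul_nonneg (sub_nonneg.2 (hf ?_))
      (sub_nonneg.2 ((complexNormalDensity_le_iff hv _ _).2 ?_))
    · rw [norm_sq_verticalReflection]; nlinarith
    · rw [norm_sq_sub_ofReal, norm_sq_sub_ofReal]; nlinarith
  · refine mul_nonneg_of_nonpos_of_nonpos (sub_nonpos.2 (hf ?_))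
      (sub_nonpos.2 ((complexNormalDensity_le_iff hv _ _).2 ?_))
    · rw [norm_sq_verticalReflection]; nlinarith
    · rw [norm_sq_sub_ofReal, norm_sq_sub_ofReal]; nlinarith

/-- The reflection preserves area and exchanges the centres `a` and `b`. Adding the difference of
the two shifted integrands to its reflected copy factors it, which also explains the factor 2. -/
lemma integrable_shiftDifference_and_integral {v : ℝ} (hv : 0 < v) {f : ℝ → ℝ} {a b : ℝ}
    (ha : Integrable (fun z : ℂ => f (‖(a : ℂ) + z‖ ^ 2)) (complexNormal v))
    (hb : Integrable (fun z : ℂ => f (‖(b : ℂ) + z‖ ^ 2)) (complexNormal v)) :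
    Integrable (shiftDifference v f a b) ∧
    ∫ w, shiftDifference v f a b w = 2 * (∫ z : ℂ, f (‖(b : ℂ) + z‖ ^ 2) ∂(complexNormal v)
      - ∫ z : ℂ, f (‖(a : ℂ) + z‖ ^ 2) ∂(complexNormal v)) := by
  have hd : Integrable (fun w : ℂ => complexNormalDensity v (w - b) * f (‖w‖ ^ 2)
      - complexNormalDensity v (w - a) * f (‖w‖ ^ 2)) :=
    (integrable_shift_complexNormal hv hb).sub (integrable_shift_complexNormal hv ha)
  have hmp := measurePreserving_verticalReflection (a + b)
  have hme := measurableEmbedding_verticalReflection (a + b)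
  have hd' := hmp.integrable_comp_of_integrable hd
  have hI := hmp.integral_comp hme (fun w : ℂ => complexNormalDensity v (w - b) * f (‖w‖ ^ 2)
      - complexNormalDensity v (w - a) * f (‖w‖ ^ 2))
  have hfun : shiftDifference v f a b = fun w =>
      (complexNormalDensity v (w - b) * f (‖w‖ ^ 2)
        - complexNormalDensity v (w - a) * f (‖w‖ ^ 2))
      + ((fun w : ℂ => complexNormalDensity v (w - b) * f (‖w‖ ^ 2)
        - complexNormalDensity v (w - a) * f (‖w‖ ^ 2)) ∘ verticalReflection (a + b)) w := by
    funext w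
    have e1 : complexNormalDensity v (verticalReflection (a + b) w - b)
        = complexNormalDensity v (w - a) := by
      unfold complexNormalDensity
      rw [norm_sq_sub_ofReal, norm_sq_sub_ofReal, norm_sq_verticalReflection]
      congr 3
      simp [verticalReflection]; ring
    have e2 : complexNormalDensity v (verticalReflection (a + b) w - a)
        = complexNormalDensity v (w - b) := by
      unfold complexNormalDensity
      rw [norm_sq_sub_ofReal, norm_sq_sub_ofReal, norm_sq_verticalReflection]
      congr 3
      simp [verticalReflection]; ring
    simp only [shiftDifference, Function.comp_apply, e1, e2]
    ring
  refine ⟨hfun ▸ hd.add hd', ?_⟩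
  rw [hfun, integral_add hd hd']
  simp only [Function.comp_apply]
  rw [hI, integral_sub (integrable_shift_complexNormal hv hb)
    (integrable_shift_complexNormal hv ha), integral_shift_complexNormal hv,
    integral_shift_complexNormal hv]
  ring

/-- Stochastic monotonicity of noncentral `χ²` laws in the noncentrality parameter. -/
lemma integral_radial_mono {v : ℝ} (hv : 0 < v) {f : ℝ → ℝ} (hf : Monotone f) {a b : ℝ}
    (ha : 0 ≤ a) (hab : a ≤ b)
    (hia : Integrable (fun z : ℂ => f (‖(a : ℂ) + z‖ ^ 2)) (complexNormal v))
    (hib : Integrable (fun z : ℂ => f (‖(b : ℂ) + z‖ ^ 2)) (complexNormal v)) :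
    ∫ z : ℂ, f (‖(a : ℂ) + z‖ ^ 2) ∂(complexNormal v)
      ≤ ∫ z : ℂ, f (‖(b : ℂ) + z‖ ^ 2) ∂(complexNormal v) := by
  have h1 := (integrable_shiftDifference_and_integral hv hia hib).2
  have h2 : 0 ≤ ∫ w, shiftDifference v f a b w :=
    integral_nonneg fun w => shiftDifference_nonneg hv hf ha hab w
  linarith

/-! ### Expected excess of a noncentral `χ²` variable over a level. -/

/-- The expected excess over `θ` of the squared modulus of a complex normal variable with mean
`a` and variance `v`. -/
noncomputable def normalExcess (v a θ : ℝ) : ℝ :=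
  ∫ z : ℂ, max (‖(a : ℂ) + z‖ ^ 2 - θ) 0 ∂(complexNormal v)

lemma integrable_normalExcess (v a θ : ℝ) :
    Integrable (fun z : ℂ => max (‖(a : ℂ) + z‖ ^ 2 - θ) 0) (complexNormal v) :=
  ((integrable_norm_sq_complexNormal v a).sub (integrable_const θ)).sup (integrable_const 0)

lemma integrable_normalDeficit (v a θ : ℝ) :
    Integrable (fun z : ℂ => max (θ - ‖(a : ℂ) + z‖ ^ 2) 0) (complexNormal v) :=
  ((integrable_const θ).sub (integrable_norm_sq_complexNormal v a)).sup (integrable_const 0)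

/-- Put-call parity: `(θ - y)⁺ = (y - θ)⁺ - y + θ`, and the mean of `y` is `a² + v`. -/
lemma integral_normalDeficit {v : ℝ} (hv : 0 ≤ v) (a θ : ℝ) :
    ∫ z : ℂ, max (θ - ‖(a : ℂ) + z‖ ^ 2) 0 ∂(complexNormal v)
      = normalExcess v a θ - (a ^ 2 + v) + θ := by
  have h : ∀ z : ℂ, max (θ - ‖(a : ℂ) + z‖ ^ 2) 0
      = max (‖(a : ℂ) + z‖ ^ 2 - θ) 0 - ‖(a : ℂ) + z‖ ^ 2 + θ := fun z => by
    rcases le_total θ (‖(a : ℂ) + z‖ ^ 2) with h | h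
    · rw [max_eq_right (by linarith), max_eq_left (by linarith)]; ring
    · rw [max_eq_left (by linarith), max_eq_right (by linarith)]; ring
  simp_rw [h]
  have h1 : Integrable (fun z : ℂ => max (‖(a : ℂ) + z‖ ^ 2 - θ) 0 - ‖(a : ℂ) + z‖ ^ 2)
    (complexNormal v) := (integrable_normalExcess v a θ).sub (integrable_norm_sq_complexNormal v a)
  rw [integral_add h1 (integrable_const _), integral_sub (integrable_normalExcess v a θ)
    (integrable_norm_sq_complexNormal v a), integral_norm_sq_complexNormal hv]
  simp [normalExcess]

lemma normalExcess_strictMono {v : ℝ} (hv : 0 < v) (θ : ℝ) {a b : ℝ} (ha : 0 ≤ a) (hab : a < b) :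
    normalExcess v a θ < normalExcess v b θ := by
  have hf : Monotone (fun y : ℝ => max (y - θ) 0) := fun x y h => max_le_max (by linarith) le_rfl
  obtain ⟨hi, he⟩ := integrable_shiftDifference_and_integral hv (f := fun y => max (y - θ) 0)
    (integrable_normalExcess v a θ) (integrable_normalExcess v b θ)
  have h0 := shiftDifference_nonneg hv hf ha hab.le
  have hpos : 0 < ∫ w, shiftDifference v (fun y => max (y - θ) 0) a b w := by
    rw [integral_pos_iff_support_of_nonneg h0 hi]
    -- Strictness: on this open set reflection strictly lowers the modulus, and the level is
    -- exceeded at `w`. The witness below is a real point far enough to the right.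
    have hU : IsOpen {w : ℂ | a + b < 2 * w.re ∧ θ < ‖w‖ ^ 2} :=
      (isOpen_lt (f := fun _ => a + b) (g := fun w : ℂ => 2 * w.re) continuous_const
        (by fun_prop)).inter
        (isOpen_lt (f := fun _ => θ) (g := fun w : ℂ => ‖w‖ ^ 2) continuous_const (by fun_prop))
    refine (hU.measure_pos volume ⟨((a + b + 1 + |θ| : ℝ) : ℂ), ?_, ?_⟩).trans_le (measure_mono ?_)
    · have := abs_nonneg θ
      simp only [Complex.ofReal_re]; linarith
    · have := abs_nonneg θ
      have h2 := le_abs_self θ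
      rw [Complex.norm_real, Real.norm_eq_abs, sq_abs]; nlinarith
    · rintro w ⟨h1, h2⟩
      have hr : ‖verticalReflection (a + b) w‖ ^ 2 < ‖w‖ ^ 2 := by
        rw [norm_sq_verticalReflection]; nlinarith
      refine (mul_pos (sub_pos.2 ?_) (sub_pos.2 (not_le.1 fun h => ?_))).ne'
      · simp only
        rw [max_eq_left (by linarith : 0 ≤ ‖w‖ ^ 2 - θ)]
        exact max_lt (by linarith) (by linarith)
      · rw [complexNormalDensity_le_iff hv, norm_sq_sub_ofReal, norm_sq_sub_ofReal] at h
        nlinarith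
  unfold normalExcess
  linarith

/-- Radial monotonicity applied to `-(θ - y)⁺`. Through the parity identity it says that the excess
grows no faster than the squared mean. -/
lemma normalDeficit_antitone {v : ℝ} (hv : 0 < v) (θ : ℝ) {a b : ℝ} (ha : 0 ≤ a) (hab : a ≤ b) :
    normalExcess v b θ - b ^ 2 ≤ normalExcess v a θ - a ^ 2 := by
  have hf : Monotone (fun y : ℝ => -max (θ - y) 0) :=
    fun x y h => neg_le_neg (max_le_max (by linarith) le_rfl)
  have h := integral_radial_mono hv hf ha hab (integrable_normalDeficit v a θ).neg
    (integrable_normalDeficit v b θ).neg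
  rw [integral_neg, integral_neg, integral_normalDeficit hv.le, integral_normalDeficit hv.le] at h
  linarith

lemma normalExcess_antitone (v a : ℝ) : Antitone (normalExcess v a) := fun θ θ' h =>
  integral_mono (integrable_normalExcess v a θ') (integrable_normalExcess v a θ)
    fun z => max_le_max (by simp only; linarith) le_rfl

lemma normalExcess_add_monotone (v a : ℝ) : Monotone (fun θ => normalExcess v a θ + θ) := by
  intro θ θ' h
  have h1 : normalExcess v a θ ≤ ∫ z : ℂ, (max (‖(a : ℂ) + z‖ ^ 2 - θ') 0 + (θ' - θ))
      ∂(complexNormal v) :=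
    integral_mono (integrable_normalExcess v a θ)
      ((integrable_normalExcess v a θ').add (integrable_const _)) fun z => by
        simp only
        rcases max_cases (‖(a : ℂ) + z‖ ^ 2 - θ') 0 with h' | h' <;>
        rcases max_cases (‖(a : ℂ) + z‖ ^ 2 - θ) 0 with h'' | h'' <;> linarith
  rw [integral_add (integrable_normalExcess v a θ') (integrable_const _)] at h1
  simp only [integral_const, probReal_univ, one_smul] at h1
  simp only [normalExcess] at *
  linarith

lemma normalExcess_nonneg (v a θ : ℝ) : 0 ≤ normalExcess v a θ :=
  integral_nonneg fun _ => le_max_right _ _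

lemma le_normalExcess {v : ℝ} (hv : 0 ≤ v) (a θ : ℝ) : a ^ 2 + v - θ ≤ normalExcess v a θ := by
  have h := integral_normalDeficit hv a θ
  have h2 : 0 ≤ ∫ z : ℂ, max (θ - ‖(a : ℂ) + z‖ ^ 2) 0 ∂(complexNormal v) :=
    integral_nonneg fun _ => le_max_right _ _
  linarith

lemma normalExcess_of_nonpos {v : ℝ} (hv : 0 ≤ v) (a : ℝ) {θ : ℝ} (hθ : θ ≤ 0) :
    normalExcess v a θ = a ^ 2 + v - θ := by
  have h := integral_normalDeficit hv a θ
  have h2 : ∫ z : ℂ, max (θ - ‖(a : ℂ) + z‖ ^ 2) 0 ∂(complexNormal v) = 0 := by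
    refine integral_eq_zero_of_ae (Filter.Eventually.of_forall fun z => max_eq_right ?_)
    have := sq_nonneg ‖(a : ℂ) + z‖
    linarith
  linarith

lemma hasDerivAt_excess_primitive {v : ℝ} (hv : 0 < v) (θ r : ℝ) :
    HasDerivAt (fun r : ℝ => -((r ^ 2 - θ + v) * Real.exp (-r ^ 2 / v)))
      (r * (2 / v * Real.exp (-r ^ 2 / v) * (r ^ 2 - θ))) r := by
  have h1 : HasDerivAt (fun r : ℝ => -r ^ 2 / v) (-(2 * r) / v) r := by
    have := ((hasDerivAt_pow 2 r).neg.div_const v)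
    simpa using this
  have h2 : HasDerivAt (fun r : ℝ => r ^ 2 - θ + v) (2 * r) r := by
    simpa using ((hasDerivAt_pow 2 r).sub_const θ).add_const v
  refine ((h2.mul h1.exp).neg).congr_deriv ?_
  field_simp
  ring

lemma tendsto_excess_primitive {v : ℝ} (hv : 0 < v) (θ : ℝ) :
    Filter.Tendsto (fun r : ℝ => -((r ^ 2 - θ + v) * Real.exp (-r ^ 2 / v))) Filter.atTop
      (nhds 0) := by
  have h1 : Filter.Tendsto (fun r : ℝ => r ^ 2 / v) Filter.atTop Filter.atTop :=
    (Filter.tendsto_pow_atTop two_ne_zero).atTop_div_const hv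
  have h2 := (Real.tendsto_pow_mul_exp_neg_atTop_nhds_zero 1).comp h1
  have h3 := (Real.tendsto_pow_mul_exp_neg_atTop_nhds_zero 0).comp h1
  have h4 := ((h2.const_mul v).add (h3.const_mul (v - θ))).neg
  simp only [mul_zero, add_zero, neg_zero] at h4
  refine h4.congr fun r => ?_
  simp only [Function.comp_apply, pow_one, pow_zero, one_mul, neg_div]
  field_simp
  ring

/-- The excess of an exponential variable. -/
lemma normalExcess_zero {v : ℝ} (hv : 0 < v) {θ : ℝ} (hθ : 0 ≤ θ) :
    normalExcess v 0 θ = v * Real.exp (-(θ / v)) := by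
  have hpi := Real.pi_pos
  have hderiv := fun r (_ : r ∈ Set.Ioi (Real.sqrt θ)) => hasDerivAt_excess_primitive hv θ r
  have hrad : ∫ r in Set.Ioi (0 : ℝ),
      r * (2 / v * Real.exp (-r ^ 2 / v) * max (r ^ 2 - θ) 0) = v * Real.exp (-(θ / v)) := by
    have hs : ∫ r in Set.Ioi (0 : ℝ), r * (2 / v * Real.exp (-r ^ 2 / v) * max (r ^ 2 - θ) 0)
        = ∫ r in Set.Ioi (Real.sqrt θ), r * (2 / v * Real.exp (-r ^ 2 / v) * (r ^ 2 - θ)) := by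
      rw [← integral_indicator measurableSet_Ioi, ← integral_indicator measurableSet_Ioi]
      congr 1
      funext r
      by_cases hr : Real.sqrt θ < r
      · have h0 : 0 < r := (Real.sqrt_nonneg θ).trans_lt hr
        rw [Set.indicator_of_mem (Set.mem_Ioi.2 hr), Set.indicator_of_mem (Set.mem_Ioi.2 h0),
          max_eq_left (sub_nonneg.2 ((Real.sqrt_lt' h0).1 hr).le)]
      · rw [Set.indicator_of_notMem (s := Set.Ioi (Real.sqrt θ)) (by simpa using hr)]
        by_cases h0 : 0 < r
        · rw [Set.indicator_of_mem (Set.mem_Ioi.2 h0), max_eq_right, mul_zero, mul_zero]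
          exact sub_nonpos.2 ((Real.le_sqrt' h0).1 (not_lt.1 hr))
        · rw [Set.indicator_of_notMem (by simpa using h0)]
    rw [hs, integral_Ioi_of_hasDerivAt_of_nonneg
      (hasDerivAt_excess_primitive hv θ _).continuousAt.continuousWithinAt hderiv ?_
      (tendsto_excess_primitive hv θ)]
    · rw [Real.sq_sqrt hθ]
      simp [neg_div]
    · intro r hr
      have h0 : 0 < r := (Real.sqrt_nonneg θ).trans_lt hr
      have : 0 ≤ r ^ 2 - θ := sub_nonneg.2 ((Real.sqrt_lt' h0).1 hr).le
      positivity
  rw [normalExcess, integral_complexNormal hv, ← Complex.integral_comp_polarCoord_symm]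
  -- The constant `1 / (π v)` is split as `(2 / v) · 1 / (2π)`, so that the angular integral equals
  -- one.
  have : ∀ p ∈ polarCoord.target, p.1 • (complexNormalDensity v (Complex.polarCoord.symm p)
      * max (‖((0 : ℝ) : ℂ) + Complex.polarCoord.symm p‖ ^ 2 - θ) 0)
      = (p.1 * (2 / v * Real.exp (-p.1 ^ 2 / v) * max (p.1 ^ 2 - θ) 0)) * (2 * Real.pi)⁻¹ := by
    intro p _
    rw [complexNormalDensity, Complex.ofReal_zero, zero_add, Complex.norm_polarCoord_symm, sq_abs]
    simp only [smul_eq_mul]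
    field_simp
  rw [setIntegral_congr_fun polarCoord.open_target.measurableSet this, polarCoord_target]
  rw [Measure.volume_eq_prod, setIntegral_prod_mul (fun r : ℝ =>
    r * (2 / v * Real.exp (-r ^ 2 / v) * max (r ^ 2 - θ) 0)) (fun _ => (2 * Real.pi)⁻¹), hrad]
  simp only [integral_const, MeasurableSet.univ, measureReal_restrict_apply, Set.univ_inter,
    smul_eq_mul, Real.volume_real_Ioo]
  rw [max_eq_left (by linarith)]
  field_simp
  ring

end DOS

/-! ### `J`, `G` and the equations' integrals in terms of the expected excess. -/

namespace DOS
namespace Params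

variable (P : Params)

lemma tau_pos : 0 < P.τ := P.τ_mem.1

lemma one_sub_tau_pos : 0 < 1 - P.τ := sub_pos.2 P.τ_mem.2

lemma ps_pos : 0 < P.ps := P.contentionProb_pos

lemma natCast_M_pos : (0 : ℝ) < P.M := Nat.cast_pos.2 P.M_pos

lemma varEst_pos : 0 < P.varEst := by
  have := P.ρ_pos; have := P.natCast_M_pos; unfold varEst; positivity

lemma varInc_pos : 0 < P.varInc := by
  have := P.ρ_pos; have := P.natCast_M_pos; unfold varInc; positivity

lemma cr_pos : 0 < P.cr := div_pos P.σ₂_mem.1 P.σ₁_mem.1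

lemma Re_pos : 0 < P.Re := by
  have := P.ρ_pos; have := P.W_pos; have := P.σ₂_mem.1; have := P.varInc_pos; unfold Re; positivity

/-- Expected excess of the second-level rate over `θ`, given the first-level rate `x`. -/
noncomputable def excess (θ x : ℝ) : ℝ := normalExcess P.Re (Real.sqrt (P.cr * x)) θ

lemma sq_sqrt_cr_mul {x : ℝ} (hx : 0 ≤ x) : Real.sqrt (P.cr * x) ^ 2 = P.cr * x :=
  Real.sq_sqrt (mul_nonneg P.cr_pos.le hx)

lemma sqrt_cr_mul_lt {x y : ℝ} (hx : 0 ≤ x) (h : x < y) :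
    Real.sqrt (P.cr * x) < Real.sqrt (P.cr * y) :=
  Real.sqrt_lt_sqrt (mul_nonneg P.cr_pos.le hx) (mul_lt_mul_of_pos_left h P.cr_pos)

lemma excess_lt {x y : ℝ} (θ : ℝ) (hx : 0 ≤ x) (h : x < y) : P.excess θ x < P.excess θ y :=
  normalExcess_strictMono P.Re_pos θ (Real.sqrt_nonneg _) (P.sqrt_cr_mul_lt hx h)

/-- Valid on all of `ℝ` because `Real.sqrt` vanishes on negative arguments; strictness can therefore
fail there, hence the case split. -/
lemma excess_monotone (θ : ℝ) : Monotone (P.excess θ) := by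
  intro x y h
  rcases (Real.sqrt_le_sqrt (mul_le_mul_of_nonneg_left h P.cr_pos.le)).eq_or_lt with h | h
  · rw [excess, excess, h]
  · exact (normalExcess_strictMono P.Re_pos θ (Real.sqrt_nonneg _) h).le

/-- The squared mean is `c_r x`, so the antitone deficit limits the slope of the excess to `c_r`.
After the factor `1 - τ` this competes with the slope one of `u - θ`. -/
lemma excess_sub_le {x y : ℝ} (θ : ℝ) (hx : 0 ≤ x) (h : x ≤ y) :
    P.excess θ y ≤ P.excess θ x + P.cr * (y - x) := by
  have h1 := normalDeficit_antitone P.Re_pos θ (Real.sqrt_nonneg (P.cr * x))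
    (Real.sqrt_le_sqrt (mul_le_mul_of_nonneg_left h P.cr_pos.le))
  rw [P.sq_sqrt_cr_mul hx, P.sq_sqrt_cr_mul (hx.trans h)] at h1
  unfold excess
  linarith

lemma excess_antitone (x : ℝ) : Antitone (fun θ => P.excess θ x) := normalExcess_antitone _ _

lemma excess_add_monotone (x : ℝ) : Monotone (fun θ => P.excess θ x + θ) :=
  normalExcess_add_monotone _ _

lemma excess_nonneg (θ x : ℝ) : 0 ≤ P.excess θ x := normalExcess_nonneg _ _ _

lemma le_excess (θ : ℝ) {x : ℝ} (hx : 0 ≤ x) : P.cr * x + P.Re - θ ≤ P.excess θ x := by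
  have := le_normalExcess P.Re_pos.le (Real.sqrt (P.cr * x)) θ
  rwa [P.sq_sqrt_cr_mul hx] at this

lemma excess_of_nonpos {θ : ℝ} (hθ : θ ≤ 0) {x : ℝ} (hx : 0 ≤ x) :
    P.excess θ x = P.cr * x + P.Re - θ := by
  rw [excess, normalExcess_of_nonpos P.Re_pos.le _ hθ, P.sq_sqrt_cr_mul hx]

/-- At `x = 0` the second-level rate is exponential with mean `R_e`; this is the origin of the
exponential in the existence hypothesis. -/
lemma excess_at_zero {θ : ℝ} (hθ : 0 ≤ θ) : P.excess θ 0 = P.Re * Real.exp (-(θ / P.Re)) := by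
  rw [excess, mul_zero, Real.sqrt_zero, normalExcess_zero P.Re_pos hθ]

lemma measurable_condLaw_map (x : ℝ) :
    Measurable (fun z : ℂ => ‖((Real.sqrt (P.cr * x) : ℝ) : ℂ) + z‖ ^ 2) := by fun_prop

instance isProbabilityMeasure_condLaw (x : ℝ) : IsProbabilityMeasure (P.condLaw x) :=
  Measure.isProbabilityMeasure_map (P.measurable_condLaw_map x).aemeasurable

lemma integral_condLaw_max_sub (θ x : ℝ) : ∫ y, max (y - θ) 0 ∂(P.condLaw x) = P.excess θ x := by
  rw [condLaw, integral_map (P.measurable_condLaw_map x).aemeasurable (by fun_prop)]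
  rfl

lemma integrable_condLaw_max_sub (θ x : ℝ) :
    Integrable (fun y => max (y - θ) 0) (P.condLaw x) := by
  rw [condLaw, integrable_map_measure (by fun_prop) (P.measurable_condLaw_map x).aemeasurable]
  exact integrable_normalExcess _ _ _

lemma integral_condLaw_max_rsub (θ : ℝ) {x : ℝ} (hx : 0 ≤ x) :
    ∫ y, max (θ - y) 0 ∂(P.condLaw x) = P.excess θ x - (P.cr * x + P.Re) + θ := by
  rw [condLaw, integral_map (P.measurable_condLaw_map x).aemeasurable (by fun_prop),
    integral_normalDeficit P.Re_pos.le, P.sq_sqrt_cr_mul hx, excess]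

lemma integrable_condLaw_max_rsub (θ x : ℝ) :
    Integrable (fun y => max (θ - y) 0) (P.condLaw x) := by
  rw [condLaw, integrable_map_measure (by fun_prop) (P.measurable_condLaw_map x).aemeasurable]
  exact integrable_normalDeficit _ _ _

lemma setIntegral_Ioi_sub_eq (ν : Measure ℝ) (θ : ℝ) :
    ∫ y in Set.Ioi θ, (y - θ) ∂ν = ∫ y, max (y - θ) 0 ∂ν := by
  rw [← integral_indicator measurableSet_Ioi]
  congr 1
  funext y
  by_cases h : θ < y
  · rw [Set.indicator_of_mem (Set.mem_Ioi.2 h), max_eq_left (by linarith)]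
  · rw [Set.indicator_of_notMem (by simpa using h), max_eq_right (by linarith)]

/-- Re-contending is worth `r = 0` at the fair price, so only this value is needed, and every
property of `J` reduces to one of the excess. -/
lemma J_zero (θ x : ℝ) : P.J θ x 0 = (1 - P.τ) * P.excess θ x - θ * P.τ := by
  rw [J, zero_div, zero_add, zero_mul, zero_add, setIntegral_Ioi_sub_eq, integral_condLaw_max_sub]

/-- Layer-cake formula for `(y - θ)⁺`. It turns the equation for `x_J` into `J_θ(x_J, 0) = 0`. -/
lemma integral_one_sub_G (θ x : ℝ) : ∫ u in Set.Ioi θ, (1 - P.G u x) = P.excess θ x := by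
  rw [← integral_condLaw_max_sub, (P.integrable_condLaw_max_sub θ x).integral_eq_integral_meas_lt
    (Filter.Eventually.of_forall fun _ => le_max_right _ _)]
  have h : ∫ u in Set.Ioi θ, (1 - P.G u x) = ∫ t in Set.Ioi 0, (1 - P.G (t + θ) x) := by
    rw [← integral_indicator measurableSet_Ioi, ← integral_indicator measurableSet_Ioi,
      ← integral_add_right_eq_self _ θ]
    congr 1
    funext t
    simp only [Set.indicator, Set.mem_Ioi, lt_add_iff_pos_left]
  rw [h]
  refine setIntegral_congr_fun measurableSet_Ioi fun t ht => ?_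
  rw [G, ← probReal_compl_eq_one_sub measurableSet_Iic]
  congr 1
  ext y
  have ht : 0 < t := ht
  simp only [Set.mem_compl_iff, Set.mem_Iic, not_le, Set.mem_ofPred_eq, lt_max_iff, ht.not_gt,
    or_false, lt_sub_iff_add_lt]

lemma G_of_neg {u : ℝ} (hu : u < 0) (x : ℝ) : P.G u x = 0 := by
  have : P.condLaw x (Set.Iic u) = 0 := by
    rw [condLaw, Measure.map_apply (P.measurable_condLaw_map x) measurableSet_Iic]
    convert measure_empty (μ := complexNormal P.Re)
    refine Set.eq_empty_of_forall_notMem fun z hz => ?_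
    have h1 : ‖((Real.sqrt (P.cr * x) : ℝ) : ℂ) + z‖ ^ 2 ≤ u := hz
    have := sq_nonneg ‖((Real.sqrt (P.cr * x) : ℝ) : ℂ) + z‖
    linarith
  simp [G, Measure.real, this]

/-- Layer-cake formula for `(θ - y)⁺`, cut off at level `θ` because rates are nonnegative. It turns
the equation for `x_q` into `J_θ(x_q, 0) = x_q - θ`. -/
lemma integral_G {θ : ℝ} (hθ : 0 ≤ θ) {x : ℝ} (hx : 0 ≤ x) :
    ∫ u in (0 : ℝ)..θ, P.G u x = P.excess θ x - (P.cr * x + P.Re) + θ := by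
  rw [← integral_condLaw_max_rsub P θ hx,
    (P.integrable_condLaw_max_rsub θ x).integral_eq_integral_meas_le
      (Filter.Eventually.of_forall fun _ => le_max_right _ _)]
  have h1 : ∫ t in Set.Ioi 0, (P.condLaw x).real {y | t ≤ max (θ - y) 0}
      = ∫ t in Set.Ioi 0, P.G (θ - t) x := by
    refine setIntegral_congr_fun measurableSet_Ioi fun t ht => ?_
    have ht : 0 < t := ht
    rw [G]
    congr 1
    ext y
    simp only [Set.mem_ofPred_eq, le_max_iff, ht.not_ge, or_false, Set.mem_Iic]
    constructor <;> intro h <;> linarith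
  have h2 : ∫ t in Set.Ioi 0, P.G (θ - t) x = ∫ t in Set.Ioc 0 θ, P.G (θ - t) x := by
    refine setIntegral_eq_of_subset_of_forall_sdiff_eq_zero measurableSet_Ioi
      Set.Ioc_subset_Ioi_self fun t ht => P.G_of_neg ?_ x
    have h3 : 0 < t := ht.1
    have h4 : ¬ t ≤ θ := fun h => ht.2 ⟨h3, h⟩
    linarith
  rw [h1, h2, ← intervalIntegral.integral_of_le hθ,
    intervalIntegral.integral_comp_sub_left (fun u => P.G u x)]
  simp

/-! ### The law of the first-level rate -/

lemma measurable_rate₁ : Measurable P.rate₁ := by unfold rate₁; fun_prop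

lemma rate₁_nonneg (h : ℂ) : 0 ≤ P.rate₁ h := by
  have := P.ρ_pos; have := P.W_pos; have := P.σ₁_mem.1; unfold rate₁; positivity

instance isProbabilityMeasure_F : IsProbabilityMeasure P.F :=
  Measure.isProbabilityMeasure_map P.measurable_rate₁.aemeasurable

lemma F_ae_nonneg : ∀ᵐ u ∂P.F, 0 ≤ u := by
  rw [F, ae_map_iff P.measurable_rate₁.aemeasurable measurableSet_Ici]
  exact Filter.Eventually.of_forall P.rate₁_nonneg

lemma integrable_id_F : Integrable (fun u : ℝ => u) P.F := by
  rw [F, integrable_map_measure (by fun_prop) P.measurable_rate₁.aemeasurable]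
  have := integrable_norm_sq_complexNormal P.varEst 0
  simp only [Complex.ofReal_zero, zero_add] at this
  exact this.const_mul _

lemma F_Ioo_pos {a b : ℝ} (ha : 0 ≤ a) (hab : a < b) : 0 < P.F (Set.Ioo a b) := by
  have : Fact (0 < P.varEst) := ⟨P.varEst_pos⟩
  have hk : 0 < P.ρ * P.W * P.σ₁ := by
    have := P.ρ_pos; have := P.W_pos; have := P.σ₁_mem.1; positivity
  rw [F, Measure.map_apply P.measurable_rate₁ measurableSet_Ioo]
  have hc : Continuous P.rate₁ := by unfold rate₁; fun_prop
  -- The witness is the real channel whose rate is the midpoint of the interval.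
  refine (isOpen_Ioo.preimage hc).measure_pos _
    ⟨((Real.sqrt ((a + b) / 2 / (P.ρ * P.W * P.σ₁)) : ℝ) : ℂ), ?_⟩
  rw [Set.mem_preimage, rate₁, Complex.norm_real, Real.norm_eq_abs, sq_abs,
    Real.sq_sqrt (div_nonneg (by linarith) hk.le), mul_div_cancel₀ _ hk.ne']
  constructor <;> linarith

end Params
end DOS

/-! ### Monotonicity of `J` in the rate and in the price. -/

namespace DOS
namespace Params

variable (P : Params)

lemma J_zero_lt {x y : ℝ} (θ : ℝ) (hx : 0 ≤ x) (h : x < y) : P.J θ x 0 < P.J θ y 0 := by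
  rw [J_zero, J_zero]
  have := mul_lt_mul_of_pos_left (P.excess_lt θ hx h) P.one_sub_tau_pos
  linarith

lemma J_zero_monotone (θ : ℝ) : Monotone (fun x => P.J θ x 0) := by
  intro x y h
  simp only [J_zero]
  have := mul_le_mul_of_nonneg_left (P.excess_monotone θ h) P.one_sub_tau_pos.le
  linarith

/-- The slope of `J` in the rate is at most `c_r (1 - τ) < 1`, so direct transmission overtakes
probing at most once. -/
lemma J_zero_sub_lt (hc : P.cr * (1 - P.τ) < 1) {x y : ℝ} (θ : ℝ) (hx : 0 ≤ x) (h : x < y) :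
    P.J θ y 0 - (y - θ) < P.J θ x 0 - (x - θ) := by
  rw [J_zero, J_zero]
  have h1 := mul_le_mul_of_nonneg_left (P.excess_sub_le θ hx h.le) P.one_sub_tau_pos.le
  nlinarith

lemma J_zero_sub_lt_iff (hc : P.cr * (1 - P.τ) < 1) {x y : ℝ} (θ : ℝ) (hx : 0 ≤ x) (hy : 0 ≤ y) :
    P.J θ y 0 - (y - θ) < P.J θ x 0 - (x - θ) ↔ x < y := by
  refine ⟨fun h => not_le.1 fun h' => ?_, P.J_zero_sub_lt hc θ hx⟩
  rcases h'.eq_or_lt with rfl | h'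
  · exact lt_irrefl _ h
  · exact lt_asymm h (P.J_zero_sub_lt hc θ hy h')

lemma J_zero_antitone (x : ℝ) : Antitone (fun θ => P.J θ x 0) := by
  intro θ θ' h
  simp only [J_zero]
  have h1 := mul_le_mul_of_nonneg_left (P.excess_antitone x h) P.one_sub_tau_pos.le
  have h2 := mul_le_mul_of_nonneg_right h P.tau_pos.le
  simp only at h1
  linarith

/-- The function equals `(1 - τ)` times excess plus price. -/
lemma J_zero_add_monotone (x : ℝ) : Monotone (fun θ => P.J θ x 0 + θ) := by
  intro θ θ' h
  simp only [J_zero]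
  have h1 := mul_le_mul_of_nonneg_left (P.excess_add_monotone x h) P.one_sub_tau_pos.le
  simp only at h1
  linarith

lemma neg_le_J_zero (θ x : ℝ) : -(θ * P.τ) ≤ P.J θ x 0 := by
  rw [J_zero]
  have := mul_nonneg P.one_sub_tau_pos.le (P.excess_nonneg θ x)
  linarith

lemma J_zero_le {θ : ℝ} (hθ : 0 ≤ θ) {x : ℝ} (hx : 0 ≤ x) : P.J θ x 0 ≤ P.cr * x + P.Re := by
  rw [J_zero]
  have h1 : P.excess θ x ≤ P.cr * x + P.Re := by
    have := P.excess_antitone x hθ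
    simp only [P.excess_of_nonpos le_rfl hx] at this
    linarith
  have h2 := mul_nonneg hθ P.tau_pos.le
  nlinarith [P.excess_nonneg θ x, P.tau_pos]

lemma measurable_J_zero (θ : ℝ) : Measurable (fun x => P.J θ x 0) := (P.J_zero_monotone θ).measurable

lemma integrable_J_zero {θ : ℝ} (hθ : 0 ≤ θ) : Integrable (fun x => P.J θ x 0) P.F := by
  refine Integrable.mono' (((P.integrable_id_F.const_mul P.cr).add (integrable_const P.Re)).add
    (integrable_const (θ * P.τ))) (P.measurable_J_zero θ).aestronglyMeasurable ?_
  filter_upwards [P.F_ae_nonneg] with x hx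
  have h1 := P.J_zero_le hθ hx
  have h2 := P.neg_le_J_zero θ x
  have h3 := mul_nonneg hθ P.tau_pos.le
  have h4 := mul_nonneg P.cr_pos.le hx
  have h5 := P.Re_pos
  rw [Real.norm_eq_abs, abs_le]
  constructor
  · simp only [Pi.add_apply]; linarith
  · simp only [Pi.add_apply]; linarith

/-! ### Net gains of a round -/

/-- The largest net gain that can be expected after observing `R⁽¹⁾ = u`, at the price `θ` per unit
of time. -/
noncomputable def gain (θ u : ℝ) : ℝ := max (max (u - θ) (P.J θ u 0)) 0

/-- The integrand of the equation for `θ_A*` when its two thresholds are in reversed order. -/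
noncomputable def reversedGain (θ u : ℝ) : ℝ := max (max (u - θ - P.J θ u 0) (u - θ)) 0

/-- The net gain of a round in which the second-level probing is never performed. -/
noncomputable def directGain (θ u : ℝ) : ℝ := max (u - θ) 0

/-- Net gains that decrease at rate at most one in the price of time. -/
structure IsPriced (H : ℝ → ℝ → ℝ) : Prop where
  integrable : ∀ θ, 0 ≤ θ → Integrable (H θ) P.F
  antitone : ∀ θ θ' u, 0 ≤ θ → θ ≤ θ' → H θ' u ≤ H θ u
  le_add : ∀ θ θ' u, 0 ≤ θ → θ ≤ θ' → H θ u ≤ H θ' u + (θ' - θ)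

variable {P}

lemma IsPriced.integral_antitone {H : ℝ → ℝ → ℝ} (hH : P.IsPriced H) {θ θ' : ℝ} (h0 : 0 ≤ θ)
    (h : θ ≤ θ') : ∫ u, H θ' u ∂P.F ≤ ∫ u, H θ u ∂P.F :=
  integral_mono (hH.integrable _ (h0.trans h)) (hH.integrable _ h0)
    fun u => hH.antitone _ _ u h0 h

lemma IsPriced.integral_le_add {H : ℝ → ℝ → ℝ} (hH : P.IsPriced H) {θ θ' : ℝ} (h0 : 0 ≤ θ)
    (h : θ ≤ θ') : ∫ u, H θ u ∂P.F ≤ ∫ u, H θ' u ∂P.F + (θ' - θ) := by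
  have h1 : ∫ u, H θ u ∂P.F ≤ ∫ u, (H θ' u + (θ' - θ)) ∂P.F :=
    integral_mono (hH.integrable _ h0)
      ((hH.integrable _ (h0.trans h)).add (integrable_const _)) fun u => hH.le_add _ _ u h0 h
  rw [integral_add (hH.integrable _ (h0.trans h)) (integrable_const _)] at h1
  simpa using h1

lemma continuousOn_of_antitone_le_add {f : ℝ → ℝ}
    (h1 : ∀ θ θ', 0 ≤ θ → θ ≤ θ' → f θ' ≤ f θ + (θ' - θ))
    (C : NNReal) (h2 : ∀ θ θ', 0 ≤ θ → θ ≤ θ' → f θ ≤ f θ' + C * (θ' - θ)) :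
    ContinuousOn f (Set.Ici 0) := by
  refine (LipschitzOnWith.of_le_add_mul (C + 1) fun x hx y hy => ?_).continuousOn
  push_cast
  have hC : (0 : ℝ) ≤ C := C.2
  rw [Real.dist_eq]
  rcases le_total x y with h | h
  · have := h2 x y hx h
    rw [abs_of_nonpos (by linarith)]
    linarith
  · have := h1 y x hy h
    rw [abs_of_nonneg (by linarith)]
    nlinarith

lemma IsPriced.continuousOn {H : ℝ → ℝ → ℝ} (hH : P.IsPriced H) :
    ContinuousOn (fun θ => ∫ u, H θ u ∂P.F) (Set.Ici 0) := by
  refine continuousOn_of_antitone_le_add (fun θ θ' h0 h => ?_) 1 fun θ θ' h0 h => ?_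
  · have := hH.integral_antitone h0 h
    linarith
  · simpa using hH.integral_le_add h0 h

lemma cost_pos : 0 < P.τ / P.ps := div_pos P.tau_pos P.ps_pos

/-- The expected gain falls while the contention cost rises strictly. This single-crossing property
drives uniqueness and every comparison of prices. -/
lemma IsPriced.lt_of_le {H : ℝ → ℝ → ℝ} (hH : P.IsPriced H) {θ θ' : ℝ} (h0 : 0 ≤ θ)
    (h : θ < θ') (he : ∫ u, H θ u ∂P.F ≤ θ * P.τ / P.ps) : ∫ u, H θ' u ∂P.F < θ' * P.τ / P.ps := by
  have h1 := hH.integral_antitone h0 h.le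
  have h2 := mul_lt_mul_of_pos_right h (P.cost_pos)
  rw [mul_div_assoc] at *
  linarith

lemma IsPriced.unique {H : ℝ → ℝ → ℝ} (hH : P.IsPriced H) {θ θ' : ℝ} (h0 : 0 ≤ θ) (h0' : 0 ≤ θ')
    (h : ∫ u, H θ u ∂P.F = θ * P.τ / P.ps) (h' : ∫ u, H θ' u ∂P.F = θ' * P.τ / P.ps) : θ = θ' := by
  rcases lt_trichotomy θ θ' with hlt | rfl | hlt
  · exact absurd h' (hH.lt_of_le h0 hlt h.le).ne
  · rfl
  · exact absurd h (hH.lt_of_le h0' hlt h'.le).ne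

lemma IsPriced.exists_eq {H : ℝ → ℝ → ℝ} (hH : P.IsPriced H) {θ : ℝ} (h0 : 0 ≤ θ)
    (h : θ * P.τ / P.ps ≤ ∫ u, H θ u ∂P.F) :
    ∃ θ', θ ≤ θ' ∧ ∫ u, H θ' u ∂P.F = θ' * P.τ / P.ps := by
  have hk := P.cost_pos
  set I := ∫ u, H θ u ∂P.F with hI
  -- At `b` the cost is at least `I`, which bounds the expected gain at all later prices; the
  -- crossing lies in `[θ, b]`.
  set b := max θ (I / (P.τ / P.ps)) with hb
  have hθb : θ ≤ b := le_max_left _ _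
  have hbI : I ≤ b * (P.τ / P.ps) := (div_le_iff₀ hk).1 (le_max_right _ _)
  have hc : ContinuousOn (fun t => ∫ u, H t u ∂P.F - t * P.τ / P.ps) (Set.Icc θ b) :=
    (hH.continuousOn.mono fun t ht => h0.trans ht.1).sub (by fun_prop)
  have h1 := hH.integral_antitone h0 hθb
  have := intermediate_value_Icc' hθb hc (show (0 : ℝ) ∈ _ from ⟨by
    rw [mul_div_assoc]; simp only [← hI] at h1 ⊢; linarith, by linarith⟩)
  obtain ⟨t, ht, he⟩ := this
  exact ⟨t, ht.1, by simp only at he; linarith⟩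

lemma directGain_antitone {θ θ' : ℝ} (h : θ ≤ θ') (u : ℝ) :
    directGain θ' u ≤ directGain θ u := max_le_max (by linarith) le_rfl

lemma integrable_directGain (θ : ℝ) : Integrable (directGain θ) P.F :=
  (P.integrable_id_F.sub (integrable_const θ)).sup (integrable_const 0)

lemma isPriced_directGain : P.IsPriced directGain where
  integrable θ _ := integrable_directGain θ
  antitone θ θ' u _ h := directGain_antitone h u
  le_add θ θ' u _ h := by
    unfold directGain
    rcases max_cases (u - θ) 0 with h1 | h1 <;> rcases max_cases (u - θ') 0 with h2 | h2 <;> linarith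

lemma isPriced_gain : P.IsPriced P.gain where
  integrable θ h := ((P.integrable_id_F.sub (integrable_const θ)).sup
    (P.integrable_J_zero h)).sup (integrable_const 0)
  antitone θ θ' u _ h := max_le_max (max_le_max (by linarith) (P.J_zero_antitone u h)) le_rfl
  le_add θ θ' u _ h := by
    have h1 := P.J_zero_add_monotone u h
    simp only at h1
    unfold gain
    refine max_le (max_le ?_ ?_) ?_
    · have := (le_max_left (u - θ') (P.J θ' u 0)).trans (le_max_left _ 0); linarith
    · have := (le_max_right (u - θ') (P.J θ' u 0)).trans (le_max_left _ 0); linarith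
    · have := le_max_right (max (u - θ') (P.J θ' u 0)) 0; linarith

/-- Since `J` enters with a minus sign, its two price bounds exchange roles compared with `gain`. -/
lemma isPriced_reversedGain : P.IsPriced P.reversedGain where
  integrable θ h := (((P.integrable_id_F.sub (integrable_const θ)).sub
    (P.integrable_J_zero h)).sup (P.integrable_id_F.sub (integrable_const θ))).sup
      (integrable_const 0)
  antitone θ θ' u _ h := by
    have h1 := P.J_zero_add_monotone u h
    simp only at h1
    exact max_le_max (max_le_max (by linarith) (by linarith)) le_rfl
  le_add θ θ' u _ h := by
    have h1 := P.J_zero_antitone u h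
    simp only at h1
    unfold reversedGain
    refine max_le (max_le ?_ ?_) ?_
    · have := (le_max_left (u - θ' - P.J θ' u 0) (u - θ')).trans (le_max_left _ 0); linarith
    · have := (le_max_right (u - θ' - P.J θ' u 0) (u - θ')).trans (le_max_left _ 0); linarith
    · have := le_max_right (max (u - θ' - P.J θ' u 0) (u - θ')) 0; linarith

lemma directGain_le_reversedGain (θ u : ℝ) : directGain θ u ≤ P.reversedGain θ u :=
  max_le_max (le_max_right _ _) le_rfl

lemma continuousOn_J_zero_self : ContinuousOn (fun θ => P.J θ θ 0) (Set.Ici 0) := by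
  have hc := P.cr_pos
  have ht := P.one_sub_tau_pos
  have ht' := P.tau_pos
  -- Along the diagonal `J` rises with slope at most `c_r (1 - τ)` and falls with slope at most one.
  -- Dividing by `c_r + 1` brings the upward slope below one.
  have h1 : ∀ θ θ', 0 ≤ θ → θ ≤ θ' →
      P.J θ' θ' 0 / (P.cr + 1) ≤ P.J θ θ 0 / (P.cr + 1) + (θ' - θ) := fun θ θ' h0 h => by
    rw [← sub_le_iff_le_add', ← sub_div, div_le_iff₀ (by linarith)]
    have h2 := P.J_zero_antitone θ' h
    have h3 := P.excess_sub_le θ h0 h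
    simp only [J_zero] at *
    have := mul_le_mul_of_nonneg_left h3 ht.le
    nlinarith [mul_nonneg hc.le (sub_nonneg.2 h)]
  have h2 : ∀ θ θ', 0 ≤ θ → θ ≤ θ' →
      P.J θ θ 0 / (P.cr + 1) ≤ P.J θ' θ' 0 / (P.cr + 1) + (1 : NNReal) * (θ' - θ) :=
      fun θ θ' h0 h => by
    rw [← sub_le_iff_le_add', ← sub_div, div_le_iff₀ (by linarith)]
    have h2 := P.J_zero_add_monotone θ h
    have h3 := P.J_zero_monotone θ' h
    simp only at h2 h3
    have : 0 ≤ (θ' - θ) * P.cr := mul_nonneg (sub_nonneg.2 h) hc.le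
    simp only [NNReal.coe_one, one_mul]
    linarith
  refine ((continuousOn_of_antitone_le_add h1 1 h2).mul_const (P.cr + 1)).congr fun θ _ => ?_
  simp only
  field_simp

/-! ### Thresholds -/

/-- The hypothesis says `J_θ(0, 0) ≤ 0`; otherwise `J_θ(·, 0)` would be positive at every
nonnegative rate. -/
lemma exists_J_zero_eq_zero {θ : ℝ} (h : P.excess θ 0 ≤ θ * P.τ / (1 - P.τ)) :
    ∃ x, 0 ≤ x ∧ P.J θ x 0 = 0 := by
  have ht := P.one_sub_tau_pos
  have hc := P.cr_pos
  have hcont : ContinuousOn (fun x => P.J θ x 0) (Set.Ici 0) := by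
    have : ContinuousOn (P.excess θ) (Set.Ici 0) := by
      refine (LipschitzOnWith.of_le_add_mul P.cr.toNNReal fun x hx y hy => ?_).continuousOn
      rw [Real.coe_toNNReal _ hc.le, Real.dist_eq]
      rcases le_total x y with h | h
      · have := P.excess_monotone θ h
        have := mul_nonneg hc.le (abs_nonneg (x - y))
        linarith
      · rw [abs_of_nonneg (by linarith)]
        exact P.excess_sub_le θ hy h
    simp only [J_zero]
    fun_prop
  have h0 : P.J θ 0 0 ≤ 0 := by
    rw [J_zero]
    have := (le_div_iff₀ ht).1 h
    linarith
  -- Chosen so that the lower bound `c_r b + R_e - θ` on the excess reaches `θ τ / (1 - τ)`.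
  set b := |θ * P.τ / (1 - P.τ) + θ| / P.cr with hb
  have hb0 : 0 ≤ b := by positivity
  have h1 : 0 ≤ P.J θ b 0 := by
    rw [J_zero]
    have h2 := P.le_excess θ hb0
    have h3 : P.cr * b = |θ * P.τ / (1 - P.τ) + θ| := by rw [hb]; field_simp
    have h4 := le_abs_self (θ * P.τ / (1 - P.τ) + θ)
    have h5 := P.Re_pos
    have h6 : θ * P.τ / (1 - P.τ) ≤ P.excess θ b := by linarith
    have := (div_le_iff₀ ht).1 h6
    linarith
  obtain ⟨x, hx, he⟩ := intermediate_value_Icc hb0 (hcont.mono fun x hx => hx.1) ⟨h0, h1⟩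
  exact ⟨x, hx.1, he⟩

lemma exists_J_zero_eq_sub (hc : P.cr * (1 - P.τ) < 1) {θ : ℝ} (hθ : 0 ≤ θ) :
    ∃ x, 0 ≤ x ∧ P.J θ x 0 = x - θ := by
  have ht := P.one_sub_tau_pos
  have hcr := P.cr_pos
  have hd : 0 < 1 - P.cr * (1 - P.τ) := by linarith
  have hbound : ∀ x y, 0 ≤ x → x ≤ y →
      P.J θ y 0 - (y - θ) ≤ P.J θ x 0 - (x - θ) - (1 - P.cr * (1 - P.τ)) * (y - x) := by
    intro x y hx h
    rw [J_zero, J_zero]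
    have h1 := mul_le_mul_of_nonneg_left (P.excess_sub_le θ hx h) ht.le
    nlinarith
  have hcont : ContinuousOn (fun x => P.J θ x 0 - (x - θ)) (Set.Ici 0) := by
    refine continuousOn_of_antitone_le_add (fun x y hx h => ?_) 1 fun x y hx h => ?_
    · have := hbound x y hx h
      have := mul_nonneg hd.le (sub_nonneg.2 h)
      linarith
    · have := P.J_zero_monotone θ h
      simp only [NNReal.coe_one, one_mul] at this ⊢
      linarith
  have h0 : 0 ≤ P.J θ 0 0 - (0 - θ) := by
    have := P.neg_le_J_zero θ 0
    nlinarith [P.τ_mem.2]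
  -- The advantage of probing decreases at rate at least `1 - c_r (1 - τ)`, so its initial value is
  -- used up by `b`.
  set b := (P.J θ 0 0 - (0 - θ)) / (1 - P.cr * (1 - P.τ)) with hb
  have hb0 : 0 ≤ b := div_nonneg h0 hd.le
  have h1 : P.J θ b 0 - (b - θ) ≤ 0 := by
    have h2 := hbound 0 b le_rfl hb0
    have h3 : (1 - P.cr * (1 - P.τ)) * (b - 0) = P.J θ 0 0 - (0 - θ) := by
      rw [hb]; field_simp; ring
    linarith
  obtain ⟨x, hx, he⟩ := intermediate_value_Icc' hb0 (hcont.mono fun x hx => hx.1) ⟨h1, h0⟩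
  exact ⟨x, hx.1, by simp only at he; linarith⟩

/-- If probing does not pay at `u = θ`, it is dominated everywhere: by giving up to the left of `θ`,
by direct transmission to the right. -/
lemma gain_eq_directGain (hc : P.cr * (1 - P.τ) < 1) {θ : ℝ} (hθ : 0 ≤ θ) (hg : P.J θ θ 0 ≤ 0)
    (u : ℝ) : P.gain θ u = directGain θ u := by
  unfold gain directGain
  rcases le_or_gt u θ with h | h
  · have := P.J_zero_monotone θ h
    rw [max_eq_right (max_le (by linarith) (le_trans this hg)), max_eq_right (by linarith)]
  · have := P.J_zero_sub_lt hc θ hθ h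
    rw [max_eq_left (a := u - θ) (by linarith)]

/-- Here `J` and `u - θ` vanish together at `u = θ`. To the left `u - θ` lies below `J` and below
zero; to the right `J > 0`, so subtracting it only loses. -/
lemma reversedGain_eq_directGain (hc : P.cr * (1 - P.τ) < 1) {θ : ℝ} (hθ : 0 ≤ θ)
    (hg : P.J θ θ 0 = 0) {u : ℝ} (hu : 0 ≤ u) : P.reversedGain θ u = directGain θ u := by
  unfold reversedGain directGain
  rcases lt_trichotomy u θ with h | rfl | h
  · have := P.J_zero_sub_lt hc θ hu h
    rw [max_eq_right (max_le (by linarith) (by linarith)), max_eq_right (by linarith)]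
  · simp [hg]
  · have := P.J_zero_lt θ hθ h
    rw [max_eq_right (a := u - θ - _) (by linarith)]

lemma integral_gain_eq_directGain (hc : P.cr * (1 - P.τ) < 1) {θ : ℝ} (hθ : 0 ≤ θ)
    (hg : P.J θ θ 0 ≤ 0) : ∫ u, P.gain θ u ∂P.F = ∫ u, directGain θ u ∂P.F :=
  integral_congr_ae (Filter.Eventually.of_forall fun u => gain_eq_directGain hc hθ hg u)

lemma integral_reversedGain_eq_directGain (hc : P.cr * (1 - P.τ) < 1) {θ : ℝ} (hθ : 0 ≤ θ)
    (hg : P.J θ θ 0 = 0) : ∫ u, P.reversedGain θ u ∂P.F = ∫ u, directGain θ u ∂P.F :=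
  integral_congr_ae (P.F_ae_nonneg.mono fun _ hu => reversedGain_eq_directGain hc hθ hg hu)

/-- At a nonpositive price the excess is `c_r x + R_e - θ > 0`, while the right side of the equation
for `x_J` is nonpositive. -/
lemma SolvesA.theta_pos {xJ xq θ : ℝ} (h : P.SolvesA xJ xq θ) : 0 < θ := by
  have h1 := h.eq_J
  rw [integral_one_sub_G] at h1
  by_contra hθ
  rw [not_lt] at hθ
  rw [P.excess_of_nonpos hθ h.xJ_nonneg] at h1
  have h2 : θ * P.τ / (1 - P.τ) ≤ 0 :=
    div_nonpos_of_nonpos_of_nonneg (mul_nonpos_of_nonpos_of_nonneg hθ P.tau_pos.le)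
      P.one_sub_tau_pos.le
  have := mul_nonneg P.cr_pos.le h.xJ_nonneg
  linarith [P.Re_pos]

lemma eq_J_iff {θ x : ℝ} :
    ∫ u in Set.Ioi θ, (1 - P.G u x) = θ * P.τ / (1 - P.τ) ↔ P.J θ x 0 = 0 := by
  rw [integral_one_sub_G, J_zero, eq_div_iff P.one_sub_tau_pos.ne', mul_comm, sub_eq_zero]

lemma eq_q_iff {θ x : ℝ} (hθ : 0 ≤ θ) (hx : 0 ≤ x) :
    (P.cr * (1 - P.τ) - 1) * x + (1 - P.τ) * (P.Re + ∫ u in (0 : ℝ)..θ, P.G u x) = 0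
      ↔ P.J θ x 0 = x - θ := by
  rw [P.integral_G hθ hx, J_zero]
  constructor <;> intro h <;> linarith

lemma SolvesA.J_xJ {xJ xq θ : ℝ} (h : P.SolvesA xJ xq θ) : P.J θ xJ 0 = 0 := eq_J_iff.1 h.eq_J

lemma SolvesA.J_xq {xJ xq θ : ℝ} (h : P.SolvesA xJ xq θ) : P.J θ xq 0 = xq - θ :=
  (eq_q_iff h.theta_pos.le h.xq_nonneg).1 h.eq_q

/-- Otherwise every term in the equation for `x_q` is nonnegative and the one with `R_e` is
positive. Hence statements about a given solution need no assumption on `c_r`. -/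
lemma SolvesA.cr_lt {xJ xq θ : ℝ} (h : P.SolvesA xJ xq θ) : P.cr * (1 - P.τ) < 1 := by
  by_contra hc
  have h1 := h.eq_q
  have h2 : 0 ≤ ∫ u in (0 : ℝ)..θ, P.G u xq :=
    intervalIntegral.integral_nonneg h.theta_pos.le fun u _ => measureReal_nonneg
  have h3 := mul_nonneg (sub_nonneg.2 (not_lt.1 hc)) h.xq_nonneg
  have h4 := mul_pos P.one_sub_tau_pos (add_pos_of_pos_of_nonneg P.Re_pos h2)
  linarith

/-- Left-hand side of the equation for `θ_A*`, thresholds in natural order. -/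
lemma integral_thresholds_eq_gain (hc : P.cr * (1 - P.τ) < 1) {xJ xq θ : ℝ} (hθ : 0 ≤ θ)
    (hxJ : 0 ≤ xJ) (hxq : 0 ≤ xq) (hJ : P.J θ xJ 0 = 0) (hq : P.J θ xq 0 = xq - θ)
    (hle : xJ ≤ xq) :
    (∫ u in xJ..xq, P.J θ u 0 ∂P.F) + (∫ u in Set.Ioi xq, (u - θ) ∂P.F)
      = ∫ u, P.gain θ u ∂P.F := by
  have hsub : Integrable (fun u => u - θ) P.F := P.integrable_id_F.sub (integrable_const θ)
  rw [intervalIntegral.integral_of_le hle, ← integral_indicator measurableSet_Ioc,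
    ← integral_indicator measurableSet_Ioi, ← integral_add
      ((P.integrable_J_zero hθ).indicator measurableSet_Ioc)
      (hsub.indicator measurableSet_Ioi)]
  refine integral_congr_ae (P.F_ae_nonneg.mono fun u hu => ?_)
  simp only [Set.indicator, Set.mem_Ioc, Set.mem_Ioi, gain]
  have hq0 : 0 ≤ xq - θ := hq ▸ hJ.ge.trans (P.J_zero_monotone θ hle)
  by_cases h1 : xJ < u
  · have e1 := P.J_zero_lt θ hxJ h1
    by_cases h2 : u ≤ xq
    · have e2 : u - θ ≤ P.J θ u 0 := by
        by_contra e
        have := (P.J_zero_sub_lt_iff hc θ hxq hu).1 (by linarith)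
        linarith
      rw [if_pos ⟨h1, h2⟩, if_neg (not_lt.2 h2), max_eq_right e2, max_eq_left (by linarith),
        add_zero]
    · have e2 := P.J_zero_sub_lt hc θ hxq (not_le.1 h2)
      rw [if_neg (fun h => h2 h.2), if_pos (not_le.1 h2), max_eq_left (a := u - θ) (by linarith),
        max_eq_left (by linarith), zero_add]
  · have e1 := P.J_zero_monotone θ (not_lt.1 h1)
    have e2 : u - θ ≤ P.J θ u 0 := by
      by_contra e
      have := (P.J_zero_sub_lt_iff hc θ hxq hu).1 (by linarith)
      linarith
    simp only at e1
    rw [if_neg (fun h => h1 h.1), if_neg (by linarith), max_eq_right (by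
      rw [max_eq_right e2]; linarith), add_zero]

/-- Left-hand side of the equation for `θ_A*`, thresholds in reversed order. -/
lemma integral_thresholds_eq_reversedGain (hc : P.cr * (1 - P.τ) < 1) {xJ xq θ : ℝ} (hθ : 0 ≤ θ)
    (hxJ : 0 ≤ xJ) (hxq : 0 ≤ xq) (hJ : P.J θ xJ 0 = 0) (hq : P.J θ xq 0 = xq - θ)
    (hle : xq ≤ xJ) :
    (∫ u in xJ..xq, P.J θ u 0 ∂P.F) + (∫ u in Set.Ioi xq, (u - θ) ∂P.F)
      = ∫ u, P.reversedGain θ u ∂P.F := by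
  have hsub : Integrable (fun u => u - θ) P.F := P.integrable_id_F.sub (integrable_const θ)
  -- Orientation makes the first integral minus the one over `(xq, xJ]`: the integrand is `u - θ -
  -- J` there and `u - θ` beyond `xJ`.
  rw [intervalIntegral.integral_of_ge hle, ← integral_indicator measurableSet_Ioc,
    ← integral_indicator measurableSet_Ioi, neg_add_eq_sub, ← integral_sub
      (hsub.indicator measurableSet_Ioi)
      ((P.integrable_J_zero hθ).indicator measurableSet_Ioc)]
  refine integral_congr_ae (P.F_ae_nonneg.mono fun u hu => ?_)
  simp only [Set.indicator, Set.mem_Ioc, Set.mem_Ioi, reversedGain]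
  by_cases h1 : xq < u
  · have e1 := P.J_zero_sub_lt hc θ hxq h1
    by_cases h2 : u ≤ xJ
    · have e2 : P.J θ u 0 ≤ 0 := (P.J_zero_monotone θ h2).trans_eq hJ
      rw [if_pos h1, if_pos ⟨h1, h2⟩, max_eq_left (a := u - θ - _) (by linarith),
        max_eq_left (by linarith)]
    · have e2 := P.J_zero_lt θ hxJ (not_le.1 h2)
      have e3 := P.J_zero_monotone θ hle
      rw [if_pos h1, if_neg (fun h => h2 h.2), max_eq_right (a := u - θ - _) (by linarith),
        max_eq_left (by linarith), sub_zero]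
  · have e1 : P.J θ u 0 ≤ 0 := 
      (P.J_zero_monotone θ ((not_lt.1 h1).trans hle)).trans_eq hJ
    have e2 : u - θ ≤ P.J θ u 0 := by
      by_contra e
      have := (P.J_zero_sub_lt_iff hc θ hxq hu).1 (by linarith)
      exact h1 this
    rw [if_neg h1, if_neg (fun h => h1 h.1), max_eq_right (max_le (by linarith) (by linarith)),
      sub_zero]

/-! ### Solutions of the threshold equations -/

lemma SolvesA.integral_gain {xJ xq θ : ℝ} (h : P.SolvesA xJ xq θ) (hle : xJ ≤ xq) :
    ∫ u, P.gain θ u ∂P.F = θ * P.τ / P.ps := by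
  rw [← integral_thresholds_eq_gain h.cr_lt h.theta_pos.le h.xJ_nonneg h.xq_nonneg h.J_xJ h.J_xq
    hle, h.eq_θ]

lemma SolvesA.integral_reversedGain {xJ xq θ : ℝ} (h : P.SolvesA xJ xq θ) (hle : xq ≤ xJ) :
    ∫ u, P.reversedGain θ u ∂P.F = θ * P.τ / P.ps := by
  rw [← integral_thresholds_eq_reversedGain h.cr_lt h.theta_pos.le h.xJ_nonneg h.xq_nonneg h.J_xJ
    h.J_xq hle, h.eq_θ]

/-- At `u = θ` direct transmission has gain zero, so the sign of `J` there locates both crossings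
relative to `θ`. -/
lemma thresholds_of_nonneg (hc : P.cr * (1 - P.τ) < 1) {xJ xq θ : ℝ} (hθ : 0 ≤ θ)
    (hxq : 0 ≤ xq) (hJ : P.J θ xJ 0 = 0) (hq : P.J θ xq 0 = xq - θ)
    (hg : 0 ≤ P.J θ θ 0) : xJ ≤ θ ∧ θ ≤ xq := by
  constructor
  · by_contra h
    have := P.J_zero_lt θ hθ (not_le.1 h)
    linarith
  · by_contra h
    have := P.J_zero_sub_lt hc θ hxq (not_le.1 h)
    linarith

lemma thresholds_of_neg (hc : P.cr * (1 - P.τ) < 1) {xJ xq θ : ℝ} (hθ : 0 ≤ θ)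
    (hJ : P.J θ xJ 0 = 0) (hq : P.J θ xq 0 = xq - θ)
    (hg : P.J θ θ 0 < 0) : θ < xJ ∧ xq < θ := by
  constructor
  · by_contra h
    have := P.J_zero_monotone θ (not_lt.1 h)
    simp only at this
    linarith
  · by_contra h
    rcases (not_lt.1 h).eq_or_lt with h | h
    · rw [← h] at hq
      linarith
    · have := P.J_zero_sub_lt hc θ hθ h
      linarith

lemma SolvesA.le_iff {xJ xq θ : ℝ} (h : P.SolvesA xJ xq θ) : xJ ≤ xq ↔ 0 ≤ P.J θ θ 0 := by
  constructor
  · intro hle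
    by_contra hg
    have := thresholds_of_neg h.cr_lt h.theta_pos.le h.J_xJ h.J_xq (not_le.1 hg)
    linarith
  · intro hg
    have := thresholds_of_nonneg h.cr_lt h.theta_pos.le h.xq_nonneg h.J_xJ h.J_xq hg
    linarith

lemma solvesB_iff {θ : ℝ} : P.SolvesB θ ↔ ∫ u, directGain θ u ∂P.F = θ * P.τ / P.ps := Iff.rfl

lemma SolvesB.nonneg {θ : ℝ} (h : P.SolvesB θ) : 0 ≤ θ := by
  have h1 : 0 ≤ ∫ u, max (u - θ) 0 ∂P.F := integral_nonneg fun _ => le_max_right _ _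
  rw [h, mul_div_assoc] at h1
  exact nonneg_of_mul_nonneg_left h1 P.cost_pos

lemma existsUnique_solvesB (P : Params) : ∃! θ : ℝ, P.SolvesB θ := by
  obtain ⟨θ, h0, h⟩ := (isPriced_directGain (P := P)).exists_eq le_rfl (by
    rw [zero_mul, zero_div]
    exact integral_nonneg fun _ => le_max_right _ _)
  exact ⟨θ, h, fun θ' h' => isPriced_directGain.unique (SolvesB.nonneg h') h0 h' h⟩

lemma exists_integral_gain_eq (P : Params) :
    ∃ θ, 0 < θ ∧ ∫ u, P.gain θ u ∂P.F = θ * P.τ / P.ps := by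
  obtain ⟨θ, h0, h⟩ := (isPriced_gain (P := P)).exists_eq le_rfl (by
    rw [zero_mul, zero_div]
    exact integral_nonneg fun _ => le_max_right _ _)
  refine ⟨θ, h0.lt_of_ne ?_, h⟩
  rintro rfl
  -- Free time makes every probing worth at least `(1 - τ) R_e`, so price zero cannot be fair.
  have h1 : ∫ _, (1 - P.τ) * P.Re ∂P.F ≤ ∫ u, P.gain 0 u ∂P.F := by
    refine integral_mono_ae (integrable_const _) (isPriced_gain.integrable 0 le_rfl) ?_
    filter_upwards [P.F_ae_nonneg] with u hu
    refine le_trans ?_ ((le_max_right (u - 0) (P.J 0 u 0)).trans (le_max_left _ 0))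
    rw [J_zero, P.excess_of_nonpos le_rfl hu]
    nlinarith [mul_nonneg P.one_sub_tau_pos.le (mul_nonneg P.cr_pos.le hu)]
  rw [h] at h1
  simp only [integral_const, probReal_univ, one_smul, zero_mul, zero_div] at h1
  exact absurd h1 (not_le.2 (mul_pos P.one_sub_tau_pos P.Re_pos))

/-- Direct and reversed expected gains agree at `θ₀`. If `θ₀ > θ₁`, this value is below the cost by
single crossing, and the reversed gain stays below it, so it could not meet the cost at `θ₂ ≥ θ₀`.
-/
lemma eq_of_mem_Icc_J_zero_self (hc : P.cr * (1 - P.τ) < 1) {θ₁ θ₀ θ₂ : ℝ} (h1 : P.SolvesB θ₁)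
    (h2 : ∫ u, P.reversedGain θ₂ u ∂P.F = θ₂ * P.τ / P.ps) (h0 : θ₀ ∈ Set.Icc θ₁ θ₂)
    (hg : P.J θ₀ θ₀ 0 = 0) : θ₁ = θ₀ ∧ θ₀ = θ₂ := by
  have hn1 := h1.nonneg
  have hn0 := hn1.trans h0.1
  have he := integral_reversedGain_eq_directGain hc hn0 hg
  rcases h0.1.eq_or_lt with rfl | hlt
  · exact ⟨rfl, isPriced_reversedGain.unique hn0 (hn0.trans h0.2) (he.trans h1) h2⟩
  · have h3 := isPriced_directGain.lt_of_le hn1 hlt (solvesB_iff.1 h1).le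
    rw [← he] at h3
    rcases h0.2.eq_or_lt with rfl | hlt'
    · exact absurd h2 h3.ne
    · exact absurd h2 (isPriced_reversedGain.lt_of_le hn0 hlt' h3.le).ne

lemma solvesB_le_of_reversedGain {θB θ : ℝ} (h : P.SolvesB θB) (hθ : 0 ≤ θ)
    (h2 : ∫ u, P.reversedGain θ u ∂P.F = θ * P.τ / P.ps) : θB ≤ θ := by
  by_contra hlt
  have h3 : ∫ u, directGain θ u ∂P.F ≤ ∫ u, P.reversedGain θ u ∂P.F :=
    integral_mono (integrable_directGain θ) (isPriced_reversedGain.integrable θ hθ)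
      fun u => directGain_le_reversedGain θ u
  exact absurd h (isPriced_directGain.lt_of_le hθ (not_le.1 hlt) (h3.trans_eq h2)).ne

/-- A positive sign at `θB` and a negative one at `θ ≥ θB` would enclose a zero of the diagonal,
which must then be `θB` itself. -/
lemma SolvesA.J_solvesB_nonpos {xJ xq θ θB : ℝ} (h : P.SolvesA xJ xq θ) (hB : P.SolvesB θB)
    (hg : P.J θ θ 0 < 0) : θB ≤ θ ∧ P.J θB θB 0 ≤ 0 := by
  have hr := thresholds_of_neg h.cr_lt h.theta_pos.le h.J_xJ h.J_xq hg
  have hrev := h.integral_reversedGain (hr.2.trans hr.1).le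
  have hle := solvesB_le_of_reversedGain hB h.theta_pos.le hrev
  refine ⟨hle, not_lt.1 fun hpos => ?_⟩
  obtain ⟨θ₀, h0, hg0⟩ := intermediate_value_Icc' hle
    (P.continuousOn_J_zero_self.mono fun t ht => hB.nonneg.trans ht.1) ⟨hg.le, hpos.le⟩
  obtain ⟨rfl, -⟩ := eq_of_mem_Icc_J_zero_self h.cr_lt hB hrev h0 hg0
  exact hpos.ne' hg0

lemma SolvesA.unique {xJ xq θ xJ' xq' θ' : ℝ} (h : P.SolvesA xJ xq θ) (h' : P.SolvesA xJ' xq' θ') :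
    xJ = xJ' ∧ xq = xq' ∧ θ = θ' := by
  obtain ⟨θB, hB, -⟩ := P.existsUnique_solvesB
  -- Solutions of both signs cannot coexist: a negative one makes `θB` fair for `gain`, so `θ = θB`
  -- and the diagonal vanishes there; then `θ'` equals the same price, contradicting its sign.
  have hmixed : ∀ {xJ xq θ xJ' xq' θ' : ℝ}, P.SolvesA xJ xq θ → P.SolvesA xJ' xq' θ' →
      0 ≤ P.J θ θ 0 → ¬ P.J θ' θ' 0 < 0 := fun {xJ xq θ xJ' xq' θ'} h h' hg hg' => by
    obtain ⟨-, hgB⟩ := h'.J_solvesB_nonpos hB hg'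
    have e1 := integral_gain_eq_directGain h.cr_lt hB.nonneg hgB
    have e2 := isPriced_gain.unique h.theta_pos.le hB.nonneg (h.integral_gain (h.le_iff.2 hg))
      (e1.trans hB)
    subst e2
    have hr := thresholds_of_neg h'.cr_lt h'.theta_pos.le h'.J_xJ h'.J_xq hg'
    have e3 := isPriced_reversedGain.unique h'.theta_pos.le h.theta_pos.le
      (h'.integral_reversedGain (hr.2.trans hr.1).le)
      ((integral_reversedGain_eq_directGain h.cr_lt hB.nonneg (le_antisymm hgB hg)).trans hB)
    subst e3
    linarith
  have hθ : θ = θ' := by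
    rcases le_or_gt 0 (P.J θ θ 0) with hg | hg
    · have hg' := not_lt.1 (hmixed h h' hg)
      exact isPriced_gain.unique h.theta_pos.le h'.theta_pos.le (h.integral_gain (h.le_iff.2 hg))
        (h'.integral_gain (h'.le_iff.2 hg'))
    · have hg' : P.J θ' θ' 0 < 0 := not_le.1 fun hn => hmixed h' h hn hg
      have hr := thresholds_of_neg h.cr_lt h.theta_pos.le h.J_xJ h.J_xq hg
      have hr' := thresholds_of_neg h'.cr_lt h'.theta_pos.le h'.J_xJ h'.J_xq hg'
      exact isPriced_reversedGain.unique h.theta_pos.le h'.theta_pos.le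
        (h.integral_reversedGain (hr.2.trans hr.1).le)
        (h'.integral_reversedGain (hr'.2.trans hr'.1).le)
  subst hθ
  refine ⟨?_, ?_, rfl⟩
  · rcases lt_trichotomy xJ xJ' with hlt | heq | hlt
    · have := P.J_zero_lt θ h.xJ_nonneg hlt
      linarith [h.J_xJ, h'.J_xJ]
    · exact heq
    · have := P.J_zero_lt θ h'.xJ_nonneg hlt
      linarith [h.J_xJ, h'.J_xJ]
  · rcases lt_trichotomy xq xq' with hlt | heq | hlt
    · have := P.J_zero_sub_lt h.cr_lt θ h.xq_nonneg hlt
      linarith [h.J_xq, h'.J_xq]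
    · exact heq
    · have := P.J_zero_sub_lt h.cr_lt θ h'.xq_nonneg hlt
      linarith [h.J_xq, h'.J_xq]

lemma exists_solvesA (hc : P.cr * (1 - P.τ) < 1) {θ : ℝ} (hθ : 0 ≤ θ)
    (he : ∫ u, P.gain θ u ∂P.F = θ * P.τ / P.ps) (h : P.excess θ 0 ≤ θ * P.τ / (1 - P.τ)) :
    ∃ xJ xq θA, P.SolvesA xJ xq θA := by
  rcases le_or_gt 0 (P.J θ θ 0) with hg | hg
  · obtain ⟨xJ, hxJ, hJ⟩ := exists_J_zero_eq_zero h
    obtain ⟨xq, hxq, hq⟩ := exists_J_zero_eq_sub hc hθ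
    have hr := thresholds_of_nonneg hc hθ hxq hJ hq hg
    exact ⟨xJ, xq, θ, hxJ, hxq, eq_J_iff.2 hJ, (eq_q_iff hθ hxq).2 hq,
      (integral_thresholds_eq_gain hc hθ hxJ hxq hJ hq (hr.1.trans hr.2)).trans he⟩
  · have hB : P.SolvesB θ := (integral_gain_eq_directGain hc hθ hg.le).symm.trans he
    -- With a negative sign the fair price does not solve the system; the solution is the later
    -- crossing of `reversedGain`.
    obtain ⟨θ', hle, he'⟩ := isPriced_reversedGain.exists_eq hθ
      (hB.symm.le.trans (integral_mono (integrable_directGain θ)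
        (isPriced_reversedGain.integrable θ hθ) fun u => directGain_le_reversedGain θ u))
    have hθ' := hθ.trans hle
    have hg' : P.J θ' θ' 0 ≤ 0 := not_lt.1 fun hpos => by
      obtain ⟨θ₀, h0, hg0⟩ := intermediate_value_Icc hle
        (P.continuousOn_J_zero_self.mono fun t ht => hθ.trans ht.1) ⟨hg.le, hpos.le⟩
      obtain ⟨rfl, -⟩ := eq_of_mem_Icc_J_zero_self hc hB he' h0 hg0
      exact hg.ne hg0
    have h' : P.excess θ' 0 ≤ θ' * P.τ / (1 - P.τ) := by
      refine (P.excess_antitone 0 hle).trans (h.trans ?_)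
      have := P.tau_pos
      have := P.one_sub_tau_pos
      gcongr
    obtain ⟨xJ, hxJ, hJ⟩ := exists_J_zero_eq_zero h'
    obtain ⟨xq, hxq, hq⟩ := exists_J_zero_eq_sub hc hθ'
    have hr : xq ≤ xJ := by
      -- If the diagonal vanishes at `θ'`, both crossings sit at `θ'` and the required order is an
      -- equality.
      rcases hg'.eq_or_lt with hg' | hg'
      · by_contra hlt
        rcases lt_or_ge xJ θ' with h1 | h1
        · have := P.J_zero_lt θ' hxJ h1
          linarith
        · have := P.J_zero_sub_lt hc θ' hθ' (h1.trans_lt (not_le.1 hlt))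
          linarith
      · have := thresholds_of_neg hc hθ' hJ hq hg'
        exact (this.2.trans this.1).le
    exact ⟨xJ, xq, θ', hxJ, hxq, eq_J_iff.2 hJ, (eq_q_iff hθ' hxq).2 hq,
      (integral_thresholds_eq_reversedGain hc hθ' hxJ hxq hJ hq hr).trans he'⟩

end Params
end DOS

/-! ### Laws and independence of the inputs of a round. -/

namespace DOS

namespace Params

variable (P : Params)

lemma measurable_rate₂ : Measurable P.rate₂ := by unfold rate₂; fun_prop

lemma rate₂_nonneg (h : ℂ) : 0 ≤ P.rate₂ h := by
  have := P.ρ_pos; have := P.W_pos; have := P.σ₂_mem.1; unfold rate₂; positivity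

/-- Given the first-level estimate, the second-level rate depends on it only through the first-level
rate. -/
lemma map_rate₂_eq_condLaw (h : ℂ) :
    (complexNormal P.varInc).map (fun e => P.rate₂ (h + e)) = P.condLaw (P.rate₁ h) := by
  -- The phase of `h`. Rotating the increment by `u` leaves its law unchanged and reduces to a real
  -- nonnegative estimate.
  obtain ⟨u, hu⟩ : ∃ u : Circle, (u : ℂ) * ‖h‖ = h := by
    rcases eq_or_ne h 0 with rfl | hne
    · exact ⟨1, by simp⟩
    · have hn : (‖h‖ : ℂ) ≠ 0 := by simpa using hne
      exact ⟨⟨h / ‖h‖, by simp [Submonoid.unitSphere, hne]⟩, by simp [div_mul_cancel₀ _ hn]⟩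
  have hk0 : 0 ≤ P.ρ * P.W * P.σ₂ := by
    have := P.ρ_pos; have := P.W_pos; have := P.σ₂_mem.1; positivity
  have hRe : P.Re = Real.sqrt (P.ρ * P.W * P.σ₂) ^ 2 * P.varInc := by
    rw [Real.sq_sqrt hk0, Re]; ring
  have hs : Real.sqrt (P.cr * P.rate₁ h) = Real.sqrt (P.ρ * P.W * P.σ₂) * ‖h‖ := by
    have : P.cr * P.rate₁ h = P.ρ * P.W * P.σ₂ * ‖h‖ ^ 2 := by
      have := P.σ₁_mem.1.ne'
      rw [cr, rate₁]
      field_simp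
    rw [this, Real.sqrt_mul hk0, Real.sqrt_sq (norm_nonneg _)]
  have hm : Measurable (fun e => P.rate₂ (h + e)) := P.measurable_rate₂.comp (by fun_prop)
  rw [condLaw, hs, hRe, ← complexNormal_map_mul, Measure.map_map (by fun_prop) (by fun_prop)]
  conv_lhs => rw [← complexNormal_map_isometry P.varInc_pos (rotation u)]
  rw [Measure.map_map hm (rotation u).continuous.measurable]
  congr 1
  funext e
  have h1 : h + rotation u e = u * (‖h‖ + e) := by
    rw [rotation_apply, mul_add, hu]
  have h2 : ((Real.sqrt (P.ρ * P.W * P.σ₂) * ‖h‖ : ℝ) : ℂ) + (Real.sqrt (P.ρ * P.W * P.σ₂) : ℝ) * e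
      = (Real.sqrt (P.ρ * P.W * P.σ₂) : ℝ) * (‖h‖ + e) := by push_cast; ring
  simp only [Function.comp_apply]
  rw [h1, h2, rate₂, norm_mul, norm_mul, Circle.norm_coe, one_mul, Complex.norm_real,
    Real.norm_of_nonneg (Real.sqrt_nonneg _), mul_pow, Real.sq_sqrt hk0]

lemma integral_rate₂_max_sub (θ : ℝ) (h : ℂ) :
    ∫ e, max (P.rate₂ (h + e) - θ) 0 ∂(complexNormal P.varInc) = P.excess θ (P.rate₁ h) := by
  have hm : Measurable (fun e => P.rate₂ (h + e)) := P.measurable_rate₂.comp (by fun_prop)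
  rw [← integral_condLaw_max_sub, ← map_rate₂_eq_condLaw, integral_map hm.aemeasurable (by fun_prop)]

/-- The law of the inputs of a round. -/
noncomputable def roundLaw : Measure (ℕ × ℂ × ℂ) :=
  (geometricLaw P.ps).prod ((complexNormal P.varEst).prod (complexNormal P.varInc))

end Params

lemma lintegral_geometricLaw (s : ℝ) (f : ℕ → ENNReal) :
    ∫⁻ k, f k ∂(geometricLaw s) = ∑' k, ENNReal.ofReal ((1 - s) ^ k * s) * f (k + 1) := by
  simp [geometricLaw, lintegral_sum_measure]

lemma lintegral_natCast_geometricLaw {s : ℝ} (h0 : 0 < s) (h1 : s ≤ 1) :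
    ∫⁻ k, ENNReal.ofReal (k : ℝ) ∂(geometricLaw s) = ENNReal.ofReal (1 / s) := by
  have hs : HasSum (fun k : ℕ => (1 - s) ^ k * s * ((k + 1 : ℕ) : ℝ)) (1 / s) := by
    have h := (hasSum_choose_mul_geometric_of_norm_lt_one 1 (r := 1 - s) (by
      rw [Real.norm_eq_abs, abs_lt]; constructor <;> linarith)).mul_right s
    have e : 1 / (1 - (1 - s)) ^ (1 + 1) * s = 1 / s := by
      rw [sub_sub_cancel]; field_simp
    rw [e] at h
    convert! h using 2 with k
    rw [Nat.choose_one_right]; ring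
  rw [lintegral_geometricLaw, ← hs.tsum_eq, ENNReal.ofReal_tsum_of_nonneg _ hs.summable]
  · refine tsum_congr fun k => ?_
    have : 0 ≤ (1 - s) ^ k * s := mul_nonneg (pow_nonneg (by linarith) _) h0.le
    rw [ENNReal.ofReal_mul this]
  · intro k
    have : 0 ≤ 1 - s := by linarith
    positivity

instance sFinite_geometricLaw (s : ℝ) : SFinite (geometricLaw s) := by
  unfold geometricLaw; infer_instance

namespace ProbingModel

variable {P : Params} {Ω : Type*} [MeasurableSpace Ω] {μ : Measure Ω} (X : ProbingModel P μ)

/-- The inputs of round `n`. -/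
def inputs (n : ℕ) (ω : Ω) : ℕ × ℂ × ℂ := (X.K n ω, X.h n ω, X.e n ω)

lemma measurable_inputs (n : ℕ) : Measurable (X.inputs n) :=
  (X.measurable_K n).prodMk ((X.measurable_h n).prodMk (X.measurable_e n))

lemma map_inputs (n : ℕ) : μ.map (X.inputs n) = P.roundLaw := X.law n

lemma measurable_R₁ (n : ℕ) : Measurable (X.R₁ n) := P.measurable_rate₁.comp (X.measurable_h n)

lemma measurable_R₂ (n : ℕ) : Measurable (X.R₂ n) :=
  P.measurable_rate₂.comp ((X.measurable_h n).add (X.measurable_e n))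

/-- The inputs of the rounds before round `n`. -/
def past (n : ℕ) (ω : Ω) (j : Finset.range n) : ℕ × ℂ × ℂ := X.inputs j ω

lemma measurable_past (n : ℕ) : Measurable (X.past n) :=
  measurable_pi_lambda _ fun j => X.measurable_inputs j

/-- The inputs of the rounds before round `n`, and those inputs of round `n` that precede the
second-level probing. -/
def preProbing (n : ℕ) (ω : Ω) : ((Finset.range n → ℕ × ℂ × ℂ) × ℕ) × ℂ :=
  ((X.past n ω, X.K n ω), X.h n ω)

lemma measurable_preProbing (n : ℕ) : Measurable (X.preProbing n) :=
  ((X.measurable_past n).prodMk (X.measurable_K n)).prodMk (X.measurable_h n)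

lemma measurable_natCast_K (n : ℕ) : Measurable (fun ω => (X.K n ω : ℝ)) :=
  measurable_from_nat.comp (X.measurable_K n)

lemma integrable_norm_sq {v : ℝ} {f : Ω → ℂ} (hf : Measurable f)
    (h : μ.map f = complexNormal v) : Integrable (fun ω => ‖f ω‖ ^ 2) μ := by
  have h1 := integrable_norm_sq_complexNormal v 0
  simp only [Complex.ofReal_zero, zero_add] at h1
  rw [← h] at h1
  exact h1.comp_measurable hf

lemma indepFun_past_inputs (n : ℕ) : IndepFun (X.past n) (X.inputs n) μ := by
  have h := X.indep.indepFun_finset (Finset.range n) {n} (by simp) X.measurable_inputs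
  exact h.comp measurable_id (measurable_pi_apply (⟨n, Finset.mem_singleton_self n⟩ : 
    ({n} : Finset ℕ)))

section Probability

variable [IsProbabilityMeasure μ]

lemma isProbabilityMeasure_roundLaw (X : ProbingModel P μ) : IsProbabilityMeasure P.roundLaw := by
  rw [← X.map_inputs 0]
  exact Measure.isProbabilityMeasure_map (X.measurable_inputs 0).aemeasurable

/-- Mass one is not derived from the formula for `p_s`: the round law is the image of a probability
measure, which forces it on the geometric factor. -/
lemma isProbabilityMeasure_geometricLaw (X : ProbingModel P μ) :
    IsProbabilityMeasure (geometricLaw P.ps) := by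
  have := X.isProbabilityMeasure_roundLaw
  have h : P.roundLaw Set.univ = 1 := measure_univ
  rw [Params.roundLaw, ← Set.univ_prod_univ, Measure.prod_prod,
    measure_univ (μ := (complexNormal P.varEst).prod _), mul_one] at h
  exact ⟨h⟩

lemma ps_le_one (X : ProbingModel P μ) : P.ps ≤ 1 := by
  have := X.isProbabilityMeasure_geometricLaw
  have h := lintegral_geometricLaw P.ps fun _ => 1
  rw [lintegral_one, measure_univ] at h
  -- The term `k = 0` of the total mass is `p_s`.
  have h0 := ENNReal.le_tsum (f := fun k => ENNReal.ofReal ((1 - P.ps) ^ k * P.ps) * 1) 0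
  rw [← h] at h0
  simpa using h0

lemma map_K (n : ℕ) : μ.map (X.K n) = geometricLaw P.ps := by
  have := X.isProbabilityMeasure_geometricLaw
  have h : X.K n = Prod.fst ∘ X.inputs n := rfl
  rw [h, ← Measure.map_map measurable_fst (X.measurable_inputs n), X.map_inputs, Params.roundLaw,
    Measure.map_fst_prod, measure_univ, one_smul]

lemma map_h (n : ℕ) : μ.map (X.h n) = complexNormal P.varEst := by
  have := X.isProbabilityMeasure_geometricLaw
  have h : X.h n = Prod.fst ∘ Prod.snd ∘ X.inputs n := rfl
  rw [h, ← Measure.map_map measurable_fst (measurable_snd.comp (X.measurable_inputs n)),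
    ← Measure.map_map measurable_snd (X.measurable_inputs n), X.map_inputs, Params.roundLaw,
    Measure.map_snd_prod, measure_univ, one_smul, Measure.map_fst_prod, measure_univ, one_smul]

lemma map_e (n : ℕ) : μ.map (X.e n) = complexNormal P.varInc := by
  have := X.isProbabilityMeasure_geometricLaw
  have h : X.e n = Prod.snd ∘ Prod.snd ∘ X.inputs n := rfl
  rw [h, ← Measure.map_map measurable_snd (measurable_snd.comp (X.measurable_inputs n)),
    ← Measure.map_map measurable_snd (X.measurable_inputs n), X.map_inputs, Params.roundLaw,
    Measure.map_snd_prod, measure_univ, one_smul, Measure.map_snd_prod, measure_univ, one_smul]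

lemma map_R₁ (n : ℕ) : μ.map (X.R₁ n) = P.F := by
  have h : X.R₁ n = P.rate₁ ∘ X.h n := rfl
  rw [h, ← Measure.map_map P.measurable_rate₁ (X.measurable_h n), X.map_h, Params.F]

lemma lintegral_K (n : ℕ) : ∫⁻ ω, ENNReal.ofReal (X.K n ω) ∂μ = ENNReal.ofReal (1 / P.ps) := by
  rw [← lintegral_natCast_geometricLaw P.ps_pos X.ps_le_one, ← X.map_K n,
    lintegral_map (by fun_prop) (X.measurable_K n)]

lemma integrable_K (n : ℕ) : Integrable (fun ω => (X.K n ω : ℝ)) μ := by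
  refine ⟨(X.measurable_natCast_K n).aestronglyMeasurable, ?_⟩
  rw [hasFiniteIntegral_iff_ofReal (Filter.Eventually.of_forall fun _ => Nat.cast_nonneg _),
    X.lintegral_K]
  exact ENNReal.ofReal_lt_top

lemma integral_K (n : ℕ) : ∫ ω, (X.K n ω : ℝ) ∂μ = 1 / P.ps := by
  rw [integral_eq_lintegral_of_nonneg_ae (Filter.Eventually.of_forall fun _ => Nat.cast_nonneg _)
    (X.measurable_natCast_K n).aestronglyMeasurable, X.lintegral_K,
    ENNReal.toReal_ofReal (one_div_pos.2 P.ps_pos).le]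

lemma integrable_comp_R₁ {g : ℝ → ℝ} (hg : Integrable g P.F) (n : ℕ) :
    Integrable (fun ω => g (X.R₁ n ω)) μ := by
  rw [← X.map_R₁ n] at hg
  exact hg.comp_measurable (X.measurable_R₁ n)

lemma integral_comp_R₁ {g : ℝ → ℝ} (hg : Measurable g) (n : ℕ) :
    ∫ ω, g (X.R₁ n ω) ∂μ = ∫ u, g u ∂P.F := by
  rw [← X.map_R₁ n, integral_map (X.measurable_R₁ n).aemeasurable hg.aestronglyMeasurable]

lemma integrable_R₁ (n : ℕ) : Integrable (X.R₁ n) μ := X.integrable_comp_R₁ P.integrable_id_F n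

lemma integrable_R₂ (n : ℕ) : Integrable (X.R₂ n) μ := by
  have h1 := integrable_norm_sq (X.measurable_h n) (X.map_h n)
  have h2 := integrable_norm_sq (X.measurable_e n) (X.map_e n)
  have hk : 0 ≤ P.ρ * P.W * P.σ₂ := by
    have := P.ρ_pos; have := P.W_pos; have := P.σ₂_mem.1; positivity
  refine Integrable.mono' (((h1.add h2).const_mul 2).const_mul (P.ρ * P.W * P.σ₂))
    (X.measurable_R₂ n).aestronglyMeasurable (Filter.Eventually.of_forall fun ω => ?_)
  have h0 : 0 ≤ X.R₂ n ω := P.rate₂_nonneg _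
  rw [Real.norm_of_nonneg h0]
  refine mul_le_mul_of_nonneg_left ?_ hk
  have h3 := norm_add_le (X.h n ω) (X.e n ω)
  have h4 := norm_nonneg (X.h n ω + X.e n ω)
  simp only [Pi.add_apply]
  nlinarith [sq_nonneg (‖X.h n ω‖ - ‖X.e n ω‖)]

lemma map_past_inputs (n : ℕ) :
    μ.map (fun ω => (X.past n ω, X.inputs n ω)) = (μ.map (X.past n)).prod P.roundLaw := by
  rw [(indepFun_iff_map_prod_eq_prod_map_map (X.measurable_past n).aemeasurable
    (X.measurable_inputs n).aemeasurable).1 (X.indepFun_past_inputs n), X.map_inputs]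

/-- Reassociating the product law isolates the increment, which is thus independent of everything
that precedes the second-level probing. -/
lemma map_preProbing_e (n : ℕ) :
    μ.map (fun ω => (X.preProbing n ω, X.e n ω))
      = (μ.map (X.preProbing n)).prod (complexNormal P.varInc) := by
  have := X.isProbabilityMeasure_geometricLaw
  have hp : IsProbabilityMeasure (μ.map (X.past n)) :=
    Measure.isProbabilityMeasure_map (X.measurable_past n).aemeasurable
  have h1 := (measurePreserving_prodAssoc (μ.map (X.past n)) (geometricLaw P.ps)
    ((complexNormal P.varEst).prod (complexNormal P.varInc))).symm
  have h2 := (measurePreserving_prodAssoc ((μ.map (X.past n)).prod (geometricLaw P.ps))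
    (complexNormal P.varEst) (complexNormal P.varInc)).symm
  have h3 := (h2.comp h1).map_eq
  have h4 := X.map_past_inputs n
  rw [Params.roundLaw] at h4
  rw [← h4, Measure.map_map (by fun_prop)
    ((X.measurable_past n).prodMk (X.measurable_inputs n))] at h3
  have h5 : μ.map (fun ω => (X.preProbing n ω, X.e n ω))
      = (((μ.map (X.past n)).prod (geometricLaw P.ps)).prod (complexNormal P.varEst)).prod
        (complexNormal P.varInc) := h3
  have h6 : μ.map (X.preProbing n)
      = ((μ.map (X.past n)).prod (geometricLaw P.ps)).prod (complexNormal P.varEst) := by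
    have : X.preProbing n = Prod.fst ∘ fun ω => (X.preProbing n ω, X.e n ω) := rfl
    rw [this, ← Measure.map_map measurable_fst
      ((X.measurable_preProbing n).prodMk (X.measurable_e n)), h5, Measure.map_fst_prod,
      measure_univ, one_smul]
  rw [h5, h6]

/-- Averaging over a second-level probing that is performed on an event of the pre-probing past. -/
lemma setIntegral_R₂_max_sub (θ : ℝ) (n : ℕ) {S} (hS : MeasurableSet S) :
    ∫ ω in X.preProbing n ⁻¹' S, max (X.R₂ n ω - θ) 0 ∂μ
      = ∫ ω in X.preProbing n ⁻¹' S, P.excess θ (X.R₁ n ω) ∂μ := by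
  have hU := X.measurable_preProbing n
  have hUe := hU.prodMk (X.measurable_e n)
  have hp : IsProbabilityMeasure (μ.map (X.preProbing n)) :=
    Measure.isProbabilityMeasure_map hU.aemeasurable
  have hf : Measurable (fun q : (((Finset.range n → ℕ × ℂ × ℂ) × ℕ) × ℂ) × ℂ =>
      max (P.rate₂ (q.1.2 + q.2) - θ) 0) :=
    ((P.measurable_rate₂.comp (by fun_prop)).sub_const θ).max measurable_const
  have hi : Integrable (fun q : (((Finset.range n → ℕ × ℂ × ℂ) × ℕ) × ℂ) × ℂ =>
      max (P.rate₂ (q.1.2 + q.2) - θ) 0)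
      ((μ.map (X.preProbing n)).prod (complexNormal P.varInc)) := by
    rw [← X.map_preProbing_e, integrable_map_measure hf.aestronglyMeasurable hUe.aemeasurable]
    exact ((X.integrable_R₂ n).sub (integrable_const θ)).sup (integrable_const 0)
  have h1 := setIntegral_map (μ := μ) (hS.prod MeasurableSet.univ) hf.aestronglyMeasurable
    hUe.aemeasurable
  rw [X.map_preProbing_e, setIntegral_prod _ hi.integrableOn] at h1
  simp only [Measure.restrict_univ, P.integral_rate₂_max_sub] at h1
  have hm : Measurable (fun o : ((Finset.range n → ℕ × ℂ × ℂ) × ℕ) × ℂ =>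
      P.excess θ (P.rate₁ o.2)) :=
    (P.excess_monotone θ).measurable.comp (P.measurable_rate₁.comp measurable_snd)
  have h5 := setIntegral_map (μ := μ) (g := X.preProbing n) hS hm.aestronglyMeasurable
    hU.aemeasurable
  rw [h5] at h1
  have h2 : (fun ω => (X.preProbing n ω, X.e n ω)) ⁻¹' (S ×ˢ Set.univ) = X.preProbing n ⁻¹' S := by
    ext ω; simp
  have h3 : ∀ ω, P.rate₁ (X.preProbing n ω).2 = X.R₁ n ω := fun _ => rfl
  have h4 : ∀ ω, P.rate₂ ((X.preProbing n ω).2 + X.e n ω) = X.R₂ n ω := fun _ => rfl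
  simp only [h2, h3, h4] at h1
  exact h1.symm

lemma setIntegral_past (n : ℕ) {S} (hS : MeasurableSet S) {g : ℕ × ℂ × ℂ → ℝ} (hg : Measurable g) :
    ∫ ω in X.past n ⁻¹' S, g (X.inputs n ω) ∂μ
      = μ.real (X.past n ⁻¹' S) * ∫ ω, g (X.inputs n ω) ∂μ := by
  have := X.isProbabilityMeasure_roundLaw
  have hp : IsProbabilityMeasure (μ.map (X.past n)) :=
    Measure.isProbabilityMeasure_map (X.measurable_past n).aemeasurable
  have h1 := setIntegral_map (μ := μ) (hS.prod MeasurableSet.univ)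
    -- The factor one presents the integrand as a product of functions of the two independent
    -- blocks.
    (f := fun q : (Finset.range n → ℕ × ℂ × ℂ) × (ℕ × ℂ × ℂ) => (1 : ℝ) * g q.2)
    (g := fun ω => (X.past n ω, X.inputs n ω))
    (measurable_const.mul (hg.comp measurable_snd)).aestronglyMeasurable
    ((X.measurable_past n).prodMk (X.measurable_inputs n)).aemeasurable
  rw [X.map_past_inputs, setIntegral_prod_mul (fun _ => (1 : ℝ)) g] at h1
  have h2 : (fun ω => (X.past n ω, X.inputs n ω)) ⁻¹' (S ×ˢ Set.univ) = X.past n ⁻¹' S := by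
    ext ω; simp
  rw [h2] at h1
  simp only [one_mul, Measure.restrict_univ, integral_const, smul_eq_mul, mul_one,
    measureReal_restrict_apply MeasurableSet.univ, Set.univ_inter] at h1
  rw [← h1, map_measureReal_apply (X.measurable_past n) hS, ← X.map_inputs n,
    integral_map (X.measurable_inputs n).aemeasurable hg.aestronglyMeasurable]

end Probability

end ProbingModel
end DOS

/-! ### Information available to a strategy, and its net gain per round. -/

namespace DOS
namespace ProbingModel

variable {P : Params} {Ω : Type*} [MeasurableSpace Ω] {μ : Measure Ω} (X : ProbingModel P μ)

/-- The information in the inputs of the rounds before round `n`. -/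
noncomputable abbrev pastAlg (n : ℕ) : MeasurableSpace Ω := MeasurableSpace.comap (X.past n) inferInstance

/-- The information in the inputs that precede the second-level probing of round `n`. -/
noncomputable abbrev preAlg (n : ℕ) : MeasurableSpace Ω := MeasurableSpace.comap (X.preProbing n) inferInstance

lemma measurable_inputs_pastAlg {j n : ℕ} (h : j < n) : Measurable[X.pastAlg n] (X.inputs j) :=
  (measurable_pi_apply (⟨j, Finset.mem_range.2 h⟩ : Finset.range n)).comp
    (comap_measurable (X.past n))

lemma measurable_pastAlg_of_inputs {j n : ℕ} (h : j < n) {β : Type*} [MeasurableSpace β]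
    {g : ℕ × ℂ × ℂ → β} (hg : Measurable g) : Measurable[X.pastAlg n] (fun ω => g (X.inputs j ω)) :=
  hg.comp (X.measurable_inputs_pastAlg h)

lemma measurable_rate₁_inputs : Measurable (fun q : ℕ × ℂ × ℂ => P.rate₁ q.2.1) :=
  P.measurable_rate₁.comp (by fun_prop)

lemma measurable_rate₂_inputs : Measurable (fun q : ℕ × ℂ × ℂ => P.rate₂ (q.2.1 + q.2.2)) :=
  P.measurable_rate₂.comp (by fun_prop)

lemma pastAlg_mono : Monotone X.pastAlg := fun m n h => by
  refine Measurable.comap_le (@measurable_pi_lambda _ _ _ (X.pastAlg n) _ _ fun j => ?_)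
  exact X.measurable_inputs_pastAlg ((Finset.mem_range.1 j.2).trans_le h)

lemma pastAlg_le_preAlg (n : ℕ) : X.pastAlg n ≤ X.preAlg n :=
  Measurable.comap_le ((measurable_fst.comp measurable_fst).comp
    (comap_measurable (X.preProbing n)))

lemma preAlg_le_pastAlg (n : ℕ) : X.preAlg n ≤ X.pastAlg (n + 1) := by
  refine Measurable.comap_le ?_
  have h1 : Measurable[X.pastAlg (n + 1)] (X.past n) :=
    (comap_measurable (X.past n)).mono (X.pastAlg_mono n.le_succ) le_rfl
  exact (h1.prodMk (X.measurable_pastAlg_of_inputs n.lt_succ_self measurable_fst)).prodMk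
    (X.measurable_pastAlg_of_inputs n.lt_succ_self (measurable_fst.comp measurable_snd))

lemma pastAlg_le (n : ℕ) : X.pastAlg n ≤ ‹MeasurableSpace Ω› := (X.measurable_past n).comap_le

lemma preAlg_le (n : ℕ) : X.preAlg n ≤ ‹MeasurableSpace Ω› := (X.measurable_preProbing n).comap_le

/-- Observations are replaced by the raw inputs they come from. The larger algebra no longer depends
on `φ` and is still independent of what comes next. -/
lemma info₁_le {φ : ℕ → Ω → Fin 3} {n : ℕ}
    (h : ∀ j < n, Measurable[X.pastAlg n] (X.outcome₂ φ j)) : X.info₁ φ n ≤ X.preAlg n := by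
  refine sup_le (iSup₂_le fun j hj => ?_) (iSup₂_le fun j hj =>
    (h j hj).comap_le.trans (X.pastAlg_le_preAlg n))
  rcases (Set.mem_Iic.1 hj).lt_or_eq with hlt | rfl
  · refine sup_le ?_ ?_
    · exact (X.measurable_pastAlg_of_inputs hlt measurable_fst).comap_le.trans
        (X.pastAlg_le_preAlg n)
    · exact (X.measurable_pastAlg_of_inputs hlt measurable_rate₁_inputs).comap_le.trans
        (X.pastAlg_le_preAlg n)
  · have hc : Measurable[X.preAlg j] (X.preProbing j) := comap_measurable _
    refine sup_le ?_ ?_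
    · exact ((measurable_snd.comp measurable_fst).comp hc).comap_le
    · exact ((P.measurable_rate₁.comp measurable_snd).comp hc).comap_le

namespace Strategy

variable {X} (s : X.Strategy)

/-- Strong induction is needed because an outcome depends on `φ n`, whose information contains the
earlier outcomes. -/
lemma measurable_outcome₂ (n : ℕ) : Measurable[X.pastAlg (n + 1)] (X.outcome₂ s.φ n) := by
  induction n using Nat.strong_induction_on with
  | _ n ih =>
    have h1 : X.info₁ s.φ n ≤ X.preAlg n := X.info₁_le fun j hj =>
      (ih j hj).mono (X.pastAlg_mono hj) le_rfl
    have h2 : Measurable[X.pastAlg (n + 1)] (s.φ n) :=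
      (s.measurable_φ n).mono (h1.trans (X.preAlg_le_pastAlg n)) le_rfl
    exact Measurable.ite (h2 (measurableSet_singleton 2))
      (X.measurable_pastAlg_of_inputs n.lt_succ_self measurable_rate₂_inputs) measurable_const

lemma info₁_le_preAlg (n : ℕ) : X.info₁ s.φ n ≤ X.preAlg n :=
  X.info₁_le fun j hj => (s.measurable_outcome₂ j).mono (X.pastAlg_mono hj) le_rfl

lemma measurable_φ_preAlg (n : ℕ) : Measurable[X.preAlg n] (s.φ n) :=
  (s.measurable_φ n).mono (s.info₁_le_preAlg n) le_rfl

lemma measurable_ψ_pastAlg (n : ℕ) : Measurable[X.pastAlg (n + 1)] (s.ψ n) :=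
  (s.measurable_ψ n).mono (sup_le ((s.info₁_le_preAlg n).trans (X.preAlg_le_pastAlg n))
    (s.measurable_outcome₂ n).comap_le) le_rfl

lemma measurableSet_probes_transmits (n : ℕ) :
    MeasurableSet[X.pastAlg (n + 1)] {ω | s.φ n ω = 2 ∧ s.ψ n ω = true} := by
  have h1 : Measurable[X.pastAlg (n + 1)] (s.φ n) :=
    (s.measurable_φ_preAlg n).mono (X.preAlg_le_pastAlg n) le_rfl
  exact MeasurableSet.inter (h1 (measurableSet_singleton 2))
    (s.measurable_ψ_pastAlg n (measurableSet_singleton true))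

lemma measurableSet_transmits (n : ℕ) :
    MeasurableSet[X.pastAlg (n + 1)] {ω | s.Transmits n ω} := by
  have h1 : Measurable[X.pastAlg (n + 1)] (s.φ n) :=
    (s.measurable_φ_preAlg n).mono (X.preAlg_le_pastAlg n) le_rfl
  exact MeasurableSet.union (h1 (measurableSet_singleton 1)) (s.measurableSet_probes_transmits n)

/-- The event that no transmission takes place before round `n`. -/
def notBefore (n : ℕ) : Set Ω := {ω | ∀ j < n, ¬ s.Transmits j ω}

lemma measurableSet_notBefore_pastAlg (n : ℕ) : MeasurableSet[X.pastAlg n] (s.notBefore n) := by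
  have h : s.notBefore n = ⋂ j, ⋂ (_ : j < n), {ω | s.Transmits j ω}ᶜ := by
    ext ω; simp [notBefore]
  rw [h]
  exact MeasurableSet.iInter fun j => MeasurableSet.iInter fun hj =>
    (X.pastAlg_mono hj _ (s.measurableSet_transmits j)).compl

lemma measurableSet_notBefore (n : ℕ) : MeasurableSet (s.notBefore n) :=
  X.pastAlg_le n _ (s.measurableSet_notBefore_pastAlg n)

lemma measurable_φ' (n : ℕ) : Measurable (s.φ n) :=
  (s.measurable_φ_preAlg n).mono (X.preAlg_le n) le_rfl

open Classical in
/-- Time spent in round `n`. -/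
noncomputable def roundTime (n : ℕ) (ω : Ω) : ℝ :=
  X.K n ω * P.τ + (if s.φ n ω = 2 then P.τ else 0)
    + if s.Transmits n ω then s.dataTime n ω else 0

/-- Data transmitted in round `n`. -/
noncomputable def roundReward (n : ℕ) (ω : Ω) : ℝ := s.rate n ω * s.dataTime n ω

lemma measurable_dataTime (n : ℕ) : Measurable (s.dataTime n) :=
  Measurable.ite (X.pastAlg_le _ _ (s.measurableSet_probes_transmits n)) measurable_const
    measurable_const

lemma measurable_rate (n : ℕ) : Measurable (s.rate n) :=
  Measurable.ite (s.measurable_φ' n (measurableSet_singleton 1)) (X.measurable_R₁ n)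
    (Measurable.ite (X.pastAlg_le _ _ (s.measurableSet_probes_transmits n)) (X.measurable_R₂ n)
      measurable_const)

lemma measurable_roundReward (n : ℕ) : Measurable (s.roundReward n) :=
  (s.measurable_rate n).mul (s.measurable_dataTime n)

lemma measurable_roundTime (n : ℕ) : Measurable (s.roundTime n) :=
  (((X.measurable_natCast_K n).mul_const _).add
    (Measurable.ite (s.measurable_φ' n (measurableSet_singleton 2)) measurable_const
      measurable_const)).add
    (Measurable.ite (X.pastAlg_le _ _ (s.measurableSet_transmits n)) (s.measurable_dataTime n)
      measurable_const)

lemma dataTime_mem (n : ℕ) (ω : Ω) : 0 ≤ s.dataTime n ω ∧ s.dataTime n ω ≤ 1 := by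
  have := P.one_sub_tau_pos
  have := P.tau_pos
  unfold dataTime
  split_ifs <;> constructor <;> linarith

lemma rate_mem (n : ℕ) (ω : Ω) : 0 ≤ s.rate n ω ∧ s.rate n ω ≤ X.R₁ n ω + X.R₂ n ω := by
  have h1 : 0 ≤ X.R₁ n ω := P.rate₁_nonneg _
  have h2 : 0 ≤ X.R₂ n ω := P.rate₂_nonneg _
  unfold rate
  split_ifs <;> constructor <;> linarith

lemma roundReward_nonneg (n : ℕ) (ω : Ω) : 0 ≤ s.roundReward n ω :=
  mul_nonneg (s.rate_mem n ω).1 (s.dataTime_mem n ω).1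

lemma roundTime_nonneg (n : ℕ) (ω : Ω) : 0 ≤ s.roundTime n ω := by
  have h1 := P.tau_pos
  have h2 := (s.dataTime_mem n ω).1
  have h3 : (0 : ℝ) ≤ X.K n ω * P.τ := by positivity
  unfold roundTime
  split_ifs <;> linarith

/-- The net gain of round `n` at the price `θ` per unit of time, when a second-level probing is
followed by a transmission exactly if its outcome exceeds `θ`. -/
noncomputable def netGain (θ : ℝ) (n : ℕ) (ω : Ω) : ℝ :=
  -(θ * P.τ * X.K n ω) + ({ω | s.φ n ω = 1}.indicator (fun ω => X.R₁ n ω - θ) ω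
    + {ω | s.φ n ω = 2}.indicator (fun ω => (1 - P.τ) * max (X.R₂ n ω - θ) 0 - θ * P.τ) ω)

/-- The net gain of round `n`, averaged over the outcome of the second-level probing. -/
noncomputable def meanNetGain (θ : ℝ) (n : ℕ) (ω : Ω) : ℝ :=
  -(θ * P.τ * X.K n ω) + ({ω | s.φ n ω = 1}.indicator (fun ω => X.R₁ n ω - θ) ω
    + {ω | s.φ n ω = 2}.indicator (fun ω => P.J θ (X.R₁ n ω) 0) ω)

/-- After a probing, transmission earns `(1 - τ)(R⁽²⁾ - θ)` and giving up earns nothing, so no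
choice beats the positive part. -/
lemma roundReward_sub_le {θ : ℝ} (n : ℕ) (ω : Ω) :
    s.roundReward n ω - θ * s.roundTime n ω ≤ s.netGain θ n ω := by
  have ht := P.one_sub_tau_pos
  have h1 := mul_le_mul_of_nonneg_left (le_max_left (X.R₂ n ω - θ) 0) ht.le
  have h2 := mul_nonneg ht.le (le_max_right (X.R₂ n ω - θ) 0)
  by_cases e1 : s.φ n ω = 1
  · simp [roundReward, roundTime, netGain, rate, dataTime, Transmits, e1]
    linarith
  · by_cases e2 : s.φ n ω = 2
    · by_cases e3 : s.ψ n ω = true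
      · simp [roundReward, roundTime, netGain, rate, dataTime, Transmits, e2, e3]
        linarith
      · simp [roundReward, roundTime, netGain, rate, dataTime, Transmits, e2, e3]
        linarith
    · simp [roundReward, roundTime, netGain, rate, dataTime, Transmits, e1, e2]
      linarith

lemma roundReward_sub_eq {θ : ℝ} {n : ℕ} {ω : Ω}
    (h : s.φ n ω = 2 → (s.ψ n ω = true ↔ θ < X.R₂ n ω)) :
    s.roundReward n ω - θ * s.roundTime n ω = s.netGain θ n ω := by
  by_cases e1 : s.φ n ω = 1
  · simp [roundReward, roundTime, netGain, rate, dataTime, Transmits, e1]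
    ring
  · by_cases e2 : s.φ n ω = 2
    · have h := h e2
      by_cases e3 : s.ψ n ω = true
      · have h4 := max_eq_left (sub_nonneg.2 (h.1 e3).le)
        simp [roundReward, roundTime, netGain, rate, dataTime, Transmits, e2, e3, h4]
        ring
      · have h4 : max (X.R₂ n ω - θ) 0 = 0 :=
          max_eq_right (sub_nonpos.2 (not_lt.1 fun h' => e3 (h.2 h')))
        simp [roundReward, roundTime, netGain, rate, dataTime, Transmits, e2, e3, h4]
        ring
    · simp [roundReward, roundTime, netGain, rate, dataTime, Transmits, e1, e2]
      ring

lemma measurableSet_φ (n : ℕ) (i : Fin 3) : MeasurableSet {ω | s.φ n ω = i} :=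
  s.measurable_φ' n (measurableSet_singleton i)

lemma meanNetGain_le (θ : ℝ) (n : ℕ) (ω : Ω) :
    s.meanNetGain θ n ω ≤ -(θ * P.τ * X.K n ω) + P.gain θ (X.R₁ n ω) := by
  unfold meanNetGain Params.gain
  by_cases e1 : s.φ n ω = 1
  · simp [e1]
  · by_cases e2 : s.φ n ω = 2
    · simp [e2]
    · simp [e1, e2]

lemma measurable_gain (θ : ℝ) : Measurable (P.gain θ) :=
  ((measurable_id.sub_const θ).max (P.measurable_J_zero θ)).max measurable_const

section Probability

variable [IsProbabilityMeasure μ]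

lemma integrable_roundReward (n : ℕ) : Integrable (s.roundReward n) μ := by
  refine Integrable.mono' ((X.integrable_R₁ n).add (X.integrable_R₂ n))
    (s.measurable_roundReward n).aestronglyMeasurable (Filter.Eventually.of_forall fun ω => ?_)
  rw [Real.norm_of_nonneg (s.roundReward_nonneg n ω)]
  have h1 := s.rate_mem n ω
  have h2 := s.dataTime_mem n ω
  exact (mul_le_of_le_one_right h1.1 h2.2).trans h1.2

lemma integrable_roundTime (n : ℕ) : Integrable (s.roundTime n) μ := by
  refine Integrable.mono' (((X.integrable_K n).mul_const P.τ).add (integrable_const 2))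
    (s.measurable_roundTime n).aestronglyMeasurable (Filter.Eventually.of_forall fun ω => ?_)
  rw [Real.norm_of_nonneg (s.roundTime_nonneg n ω)]
  have h1 := P.τ_mem.1
  have h3 := P.τ_mem.2
  have h2 := s.dataTime_mem n ω
  simp only [Pi.add_apply]
  unfold roundTime
  split_ifs <;> linarith

lemma integrable_R₂_max (X : ProbingModel P μ) (θ : ℝ) (n : ℕ) :
    Integrable (fun ω => max (X.R₂ n ω - θ) 0) μ :=
  ((X.integrable_R₂ n).sub (integrable_const θ)).sup (integrable_const 0)

lemma integrable_contention (X : ProbingModel P μ) (θ : ℝ) (n : ℕ) :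
    Integrable (fun ω => -(θ * P.τ * X.K n ω)) μ := ((X.integrable_K n).const_mul _).neg

lemma integrable_direct (θ : ℝ) (n : ℕ) :
    Integrable ({ω | s.φ n ω = 1}.indicator (fun ω => X.R₁ n ω - θ)) μ :=
  ((X.integrable_R₁ n).sub (integrable_const θ)).indicator (s.measurableSet_φ n 1)

lemma integrable_probing (θ : ℝ) (n : ℕ) : Integrable ({ω | s.φ n ω = 2}.indicator
    (fun ω => (1 - P.τ) * max (X.R₂ n ω - θ) 0 - θ * P.τ)) μ :=
  (((integrable_R₂_max X θ n).const_mul _).sub (integrable_const _)).indicator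
    (s.measurableSet_φ n 2)

lemma integrable_meanProbing {θ : ℝ} (hθ : 0 ≤ θ) (n : ℕ) : Integrable ({ω | s.φ n ω = 2}.indicator
    (fun ω => P.J θ (X.R₁ n ω) 0)) μ :=
  (X.integrable_comp_R₁ (P.integrable_J_zero hθ) n).indicator (s.measurableSet_φ n 2)

lemma integrable_netGain (θ : ℝ) (n : ℕ) : Integrable (s.netGain θ n) μ :=
  (integrable_contention X θ n).add ((s.integrable_direct θ n).add (s.integrable_probing θ n))

lemma integrable_meanNetGain {θ : ℝ} (hθ : 0 ≤ θ) (n : ℕ) : Integrable (s.meanNetGain θ n) μ :=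
  (integrable_contention X θ n).add ((s.integrable_direct θ n).add (s.integrable_meanProbing hθ n))

/-- The event that round `n` is probed, intersected with `A`, is decided before the increment is
seen; averaging over the independent increment produces `J`. -/
lemma setIntegral_netGain {θ : ℝ} (hθ : 0 ≤ θ) {n : ℕ} {A : Set Ω}
    (hA : MeasurableSet[X.pastAlg n] A) :
    ∫ ω in A, s.netGain θ n ω ∂μ = ∫ ω in A, s.meanNetGain θ n ω ∂μ := by
  have h1 : ∫ ω in A, {ω | s.φ n ω = 2}.indicator
      (fun ω => (1 - P.τ) * max (X.R₂ n ω - θ) 0 - θ * P.τ) ω ∂μ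
      = ∫ ω in A, {ω | s.φ n ω = 2}.indicator (fun ω => P.J θ (X.R₁ n ω) 0) ω ∂μ := by
    rw [setIntegral_indicator (s.measurableSet_φ n 2), setIntegral_indicator (s.measurableSet_φ n 2)]
    obtain ⟨S, hS, hSA⟩ : MeasurableSet[X.preAlg n] (A ∩ {ω | s.φ n ω = 2}) :=
      (X.pastAlg_le_preAlg n _ hA).inter (s.measurable_φ_preAlg n (measurableSet_singleton 2))
    have hex : Integrable (fun ω => P.excess θ (X.R₁ n ω)) μ := by
      have h := (X.integrable_comp_R₁ (P.integrable_J_zero hθ) n).add (integrable_const (θ * P.τ))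
      refine (h.const_mul (1 - P.τ)⁻¹).congr (Filter.Eventually.of_forall fun ω => ?_)
      have := P.one_sub_tau_pos.ne'
      simp only [Pi.add_apply, Params.J_zero]
      field_simp
      ring
    simp only [Params.J_zero]
    rw [← hSA, integral_sub ((integrable_R₂_max X θ n).const_mul _).integrableOn
      (integrable_const _), integral_sub (hex.const_mul _).integrableOn (integrable_const _),
      integral_const_mul (1 - P.τ), integral_const_mul (1 - P.τ), X.setIntegral_R₂_max_sub θ n hS]
  have h2 : Integrable (fun ω => {ω | s.φ n ω = 1}.indicator (fun ω => X.R₁ n ω - θ) ω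
      + {ω | s.φ n ω = 2}.indicator
        (fun ω => (1 - P.τ) * max (X.R₂ n ω - θ) 0 - θ * P.τ) ω) μ :=
    (s.integrable_direct θ n).add (s.integrable_probing θ n)
  have h3 : Integrable (fun ω => {ω | s.φ n ω = 1}.indicator (fun ω => X.R₁ n ω - θ) ω
      + {ω | s.φ n ω = 2}.indicator (fun ω => P.J θ (X.R₁ n ω) 0) ω) μ :=
    (s.integrable_direct θ n).add (s.integrable_meanProbing hθ n)
  unfold netGain meanNetGain
  rw [integral_add (integrable_contention X θ n).integrableOn h2.integrableOn,
    integral_add (integrable_contention X θ n).integrableOn h3.integrableOn,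
    integral_add (s.integrable_direct θ n).integrableOn (s.integrable_probing θ n).integrableOn,
    integral_add (s.integrable_direct θ n).integrableOn
      (s.integrable_meanProbing hθ n).integrableOn, h1]

lemma integral_contention (X : ProbingModel P μ) (θ : ℝ) (n : ℕ) :
    ∫ ω, -(θ * P.τ * X.K n ω) ∂μ = -(θ * P.τ / P.ps) := by
  rw [integral_neg, integral_const_mul, X.integral_K, mul_one_div]

/-- At the price that makes a round with optimal decisions fair, no strategy gains in any round. -/
lemma setIntegral_roundReward_le {θ : ℝ} (hθ : 0 ≤ θ)
    (he : ∫ u, P.gain θ u ∂P.F = θ * P.τ / P.ps) (n : ℕ) :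
    ∫ ω in s.notBefore n, s.roundReward n ω ∂μ ≤ θ * ∫ ω in s.notBefore n, s.roundTime n ω ∂μ := by
  have hA := s.measurableSet_notBefore_pastAlg n
  have hi := X.integrable_comp_R₁ (Params.isPriced_gain.integrable θ hθ) n
  have h1 : ∫ ω in s.notBefore n, (s.roundReward n ω - θ * s.roundTime n ω) ∂μ
      ≤ ∫ ω in s.notBefore n, s.netGain θ n ω ∂μ :=
    setIntegral_mono ((s.integrable_roundReward n).sub
      ((s.integrable_roundTime n).const_mul θ)).integrableOn (s.integrable_netGain θ n).integrableOn
      fun ω => s.roundReward_sub_le n ω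
  rw [s.setIntegral_netGain hθ hA] at h1
  have h2 : ∫ ω in s.notBefore n, s.meanNetGain θ n ω ∂μ
      ≤ ∫ ω in s.notBefore n, (-(θ * P.τ * X.K n ω) + P.gain θ (X.R₁ n ω)) ∂μ :=
    setIntegral_mono (s.integrable_meanNetGain hθ n).integrableOn
      ((integrable_contention X θ n).add hi).integrableOn fun ω => s.meanNetGain_le θ n ω
  -- The event of reaching round `n` belongs to the past, so the integral factors; the round's own
  -- factor is zero by fairness of `θ`.
  obtain ⟨S, hS, hSA⟩ := hA
  have h3 := X.setIntegral_past n hS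
    (g := fun q => -(θ * P.τ * q.1) + P.gain θ (P.rate₁ q.2.1)) (by
      have := (measurable_gain (P := P) θ).comp (measurable_rate₁_inputs (P := P))
      have h4 : Measurable (fun q : ℕ × ℂ × ℂ => (q.1 : ℝ)) :=
        measurable_from_nat.comp measurable_fst
      exact (h4.const_mul _).neg.add this)
  have h4 : ∫ ω, (-(θ * P.τ * X.K n ω) + P.gain θ (X.R₁ n ω)) ∂μ = 0 := by
    rw [integral_add (integrable_contention X θ n) hi, integral_contention,
      X.integral_comp_R₁ (measurable_gain θ), he]
    ring
  have h5 : ∫ ω in s.notBefore n, (-(θ * P.τ * X.K n ω) + P.gain θ (X.R₁ n ω)) ∂μ = 0 := by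
    rw [← hSA]
    refine h3.trans ?_
    have h6 : ∫ ω, (-(θ * P.τ * (X.inputs n ω).1) + P.gain θ (P.rate₁ (X.inputs n ω).2.1)) ∂μ = 0 :=
      h4
    rw [h6, mul_zero]
  rw [integral_sub (s.integrable_roundReward n).integrableOn
    ((s.integrable_roundTime n).const_mul θ).integrableOn, integral_const_mul] at h1
  linarith

end Probability

end Strategy
end ProbingModel
end DOS

/-! ### Decomposition over rounds and the upper bound on the throughput. -/

namespace DOS
namespace ProbingModel

variable {P : Params} {Ω : Type*} [MeasurableSpace Ω] {μ : Measure Ω} {X : ProbingModel P μ}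

namespace Strategy

variable (s : X.Strategy)

lemma stopRound_le {ω : Ω} {n : ℕ} (h : s.Transmits n ω) : s.stopRound ω ≤ n := Nat.sInf_le h

lemma mem_notBefore_iff {ω : Ω} (h : ∃ n, s.Transmits n ω) (n : ℕ) :
    ω ∈ s.notBefore n ↔ n ≤ s.stopRound ω := by
  constructor
  · intro hn
    by_contra hlt
    exact hn _ (not_le.1 hlt) (Nat.sInf_mem h)
  · intro hn j hj hT
    have := s.stopRound_le hT
    omega

lemma transmits_stopRound {ω : Ω} (h : ∃ n, s.Transmits n ω) : s.Transmits (s.stopRound ω) ω :=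
  Nat.sInf_mem h

lemma not_transmits_of_lt {ω : Ω} {n : ℕ} (hn : n < s.stopRound ω) : ¬ s.Transmits n ω :=
  fun hT => hn.not_ge (s.stopRound_le hT)

lemma roundReward_of_not_transmits {n : ℕ} {ω : Ω} (h : ¬ s.Transmits n ω) :
    s.roundReward n ω = 0 := by
  rw [Transmits, not_or] at h
  rw [roundReward, rate, if_neg h.1, if_neg h.2, zero_mul]

/-- Rounds before the stopping round earn nothing and later ones are removed by the indicator.
Summing over the events of reaching round `n` lets each round be bounded separately. -/
lemma reward_eq_tsum {ω : Ω} (h : ∃ n, s.Transmits n ω) :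
    ENNReal.ofReal (s.rate (s.stopRound ω) ω * s.dataTime (s.stopRound ω) ω)
      = ∑' n, (s.notBefore n).indicator (fun ω => ENNReal.ofReal (s.roundReward n ω)) ω := by
  rw [tsum_eq_single (s.stopRound ω), Set.indicator_of_mem ((s.mem_notBefore_iff h _).2 le_rfl),
    roundReward]
  intro n hn
  rcases hn.lt_or_gt with hlt | hlt
  · rw [Set.indicator_apply_eq_zero]
    intro _
    rw [s.roundReward_of_not_transmits (s.not_transmits_of_lt hlt), ENNReal.ofReal_zero]
  · exact Set.indicator_of_notMem (fun hm => by have := (s.mem_notBefore_iff h n).1 hm; omega) _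

lemma totalTime_eq_sum {ω : Ω} (h : ∃ n, s.Transmits n ω) :
    s.totalTime (s.stopRound ω) ω
      = ∑ j ∈ Finset.range (s.stopRound ω + 1), s.roundTime j ω := by
  rw [totalTime, Finset.sum_range_succ, Finset.sum_range_succ]
  have h1 : ∑ j ∈ Finset.range (s.stopRound ω), s.roundTime j ω
      = ∑ j ∈ Finset.range (s.stopRound ω),
        ((X.K j ω : ℝ) * P.τ + if s.φ j ω = 2 then P.τ else 0) := by
    refine Finset.sum_congr rfl fun j hj => ?_
    rw [roundTime, if_neg (s.not_transmits_of_lt (Finset.mem_range.1 hj)), add_zero]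
  rw [h1, roundTime, if_pos (s.transmits_stopRound h), add_assoc]

lemma time_eq_tsum {ω : Ω} (h : ∃ n, s.Transmits n ω) :
    ENNReal.ofReal (s.totalTime (s.stopRound ω) ω)
      = ∑' n, (s.notBefore n).indicator (fun ω => ENNReal.ofReal (s.roundTime n ω)) ω := by
  rw [s.totalTime_eq_sum h, ENNReal.ofReal_sum_of_nonneg fun j _ => s.roundTime_nonneg j ω,
    tsum_eq_sum (s := Finset.range (s.stopRound ω + 1))]
  · refine Finset.sum_congr rfl fun j hj => ?_
    rw [Set.indicator_of_mem]
    exact (s.mem_notBefore_iff h j).2 (by have := Finset.mem_range.1 hj; omega)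
  · intro n hn
    refine Set.indicator_of_notMem (fun hm => hn ?_) _
    have := (s.mem_notBefore_iff h n).1 hm
    exact Finset.mem_range.2 (by omega)

lemma lintegral_tsum_indicator {A : ℕ → Set Ω} (hA : ∀ n, MeasurableSet (A n)) {f : ℕ → Ω → ℝ}
    (hf : ∀ n, Integrable (f n) μ) (hf' : ∀ n, Measurable (f n)) (h0 : ∀ n ω, 0 ≤ f n ω) :
    ∫⁻ ω, ∑' n, (A n).indicator (fun ω => ENNReal.ofReal (f n ω)) ω ∂μ
      = ∑' n, ENNReal.ofReal (∫ ω in A n, f n ω ∂μ) := by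
  rw [lintegral_tsum fun n => ((hf' n).ennreal_ofReal.indicator (hA n)).aemeasurable]
  refine tsum_congr fun n => ?_
  rw [lintegral_indicator (hA n), ofReal_integral_eq_lintegral_ofReal (hf n).integrableOn
    (Filter.Eventually.of_forall fun ω => h0 n ω)]

section Probability

variable [IsProbabilityMeasure μ]

lemma expectedReward_eq_tsum (h : ∀ᵐ ω ∂μ, ∃ n, s.Transmits n ω) :
    s.expectedReward = ∑' n, ENNReal.ofReal (∫ ω in s.notBefore n, s.roundReward n ω ∂μ) := by
  rw [← lintegral_tsum_indicator s.measurableSet_notBefore s.integrable_roundReward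
    s.measurable_roundReward s.roundReward_nonneg]
  exact lintegral_congr_ae (h.mono fun ω hω => s.reward_eq_tsum hω)

lemma expectedTime_eq_tsum (h : ∀ᵐ ω ∂μ, ∃ n, s.Transmits n ω) :
    s.expectedTime = ∑' n, ENNReal.ofReal (∫ ω in s.notBefore n, s.roundTime n ω ∂μ) := by
  rw [← lintegral_tsum_indicator s.measurableSet_notBefore s.integrable_roundTime
    s.measurable_roundTime s.roundTime_nonneg]
  exact lintegral_congr_ae (h.mono fun ω hω => s.time_eq_tsum hω)

/-- The price that makes a round with optimal decisions fair bounds every throughput. -/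
lemma throughput_le {θ : ℝ} (hθ : 0 ≤ θ) (he : ∫ u, P.gain θ u ∂P.F = θ * P.τ / P.ps)
    (h : s.Admissible) : s.throughput ≤ ENNReal.ofReal θ := by
  refine ENNReal.div_le_of_le_mul ?_
  rw [s.expectedReward_eq_tsum h.1, s.expectedTime_eq_tsum h.1, ← ENNReal.tsum_mul_left]
  refine ENNReal.tsum_le_tsum fun n => ?_
  rw [← ENNReal.ofReal_mul hθ]
  exact ENNReal.ofReal_le_ofReal (s.setIntegral_roundReward_le hθ he n)

lemma setIntegral_notBefore (n : ℕ) {g : ℕ × ℂ × ℂ → ℝ} (hg : Measurable g) :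
    ∫ ω in s.notBefore n, g (X.inputs n ω) ∂μ
      = μ.real (s.notBefore n) * ∫ ω, g (X.inputs 0 ω) ∂μ := by
  obtain ⟨S, hS, hSA⟩ := s.measurableSet_notBefore_pastAlg n
  rw [← hSA, X.setIntegral_past n hS hg,
    ← integral_map (X.measurable_inputs n).aemeasurable hg.aestronglyMeasurable,
    ← integral_map (X.measurable_inputs 0).aemeasurable hg.aestronglyMeasurable, X.map_inputs,
    X.map_inputs]

lemma roundTime_integral_pos : 0 < ∫ ω, s.roundTime 0 ω ∂μ := by
  have h1 : ∫ ω, (X.K 0 ω : ℝ) * P.τ ∂μ ≤ ∫ ω, s.roundTime 0 ω ∂μ := by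
    refine integral_mono ((X.integrable_K 0).mul_const _) (s.integrable_roundTime 0) fun ω => ?_
    have h2 := (s.dataTime_mem 0 ω).1
    have h3 := P.tau_pos
    unfold roundTime
    simp only
    split_ifs <;> linarith
  rw [integral_mul_const, X.integral_K] at h1
  exact (mul_pos (one_div_pos.2 P.ps_pos) P.tau_pos).trans_le h1

end Probability

end Strategy

/-! ### Stationary strategies -/

section Stationary

/-- The inputs of a round that lead to a transmission at the second-level rate. -/
def probedSet (P : Params) (f : ℝ → Fin 3) (g : ℝ → Bool) : Set (ℕ × ℂ × ℂ) :=
  {q | f (P.rate₁ q.2.1) = 2 ∧ g (P.rate₂ (q.2.1 + q.2.2)) = true}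

/-- The inputs of a round that lead to a transmission. -/
def transmitSet (P : Params) (f : ℝ → Fin 3) (g : ℝ → Bool) : Set (ℕ × ℂ × ℂ) :=
  {q | f (P.rate₁ q.2.1) = 1} ∪ probedSet P f g

lemma measurableSet_firstLevel {f : ℝ → Fin 3} (hf : Measurable f) (P : Params) (i : Fin 3) :
    MeasurableSet {q : ℕ × ℂ × ℂ | f (P.rate₁ q.2.1) = i} :=
  (hf.comp (measurable_rate₁_inputs (P := P))) (measurableSet_singleton i)

lemma measurableSet_probedSet {f : ℝ → Fin 3} (hf : Measurable f) {g : ℝ → Bool}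
    (hg : Measurable g) (P : Params) :
    MeasurableSet (probedSet P f g) :=
  (measurableSet_firstLevel hf P 2).inter
    ((hg.comp (measurable_rate₂_inputs (P := P))) (measurableSet_singleton true))

lemma measurableSet_transmitSet {f : ℝ → Fin 3} (hf : Measurable f) {g : ℝ → Bool}
    (hg : Measurable g) (P : Params) :
    MeasurableSet (transmitSet P f g) :=
  (measurableSet_firstLevel hf P 1).union (measurableSet_probedSet hf hg P)

variable {f : ℝ → Fin 3} (hf : Measurable f) {g : ℝ → Bool} (hg : Measurable g)

/-- The default outcome `0` plays no role, since `ψ` is consulted only when the probing took place.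
-/
lemma stationary_probes_iff (n : ℕ) (ω : Ω) :
    ((X.stationary f hf g hg).φ n ω = 2 ∧ (X.stationary f hf g hg).ψ n ω = true)
      ↔ X.inputs n ω ∈ probedSet P f g := by
  refine and_congr_right fun h => ?_
  have h1 : (X.stationary f hf g hg).ψ n ω
      = g (if (X.stationary f hf g hg).φ n ω = 2 then X.R₂ n ω else 0) := rfl
  rw [h1, if_pos h]
  rfl

lemma stationary_transmits_iff (n : ℕ) (ω : Ω) :
    (X.stationary f hf g hg).Transmits n ω ↔ X.inputs n ω ∈ transmitSet P f g :=
  or_congr Iff.rfl (stationary_probes_iff hf hg n ω)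

lemma exists_roundReward_eq : ∃ G : ℕ × ℂ × ℂ → ℝ, Measurable G ∧
    ∀ n ω, (X.stationary f hf g hg).roundReward n ω = G (X.inputs n ω) := by
  classical
  refine ⟨fun q => (if q ∈ {q : ℕ × ℂ × ℂ | f (P.rate₁ q.2.1) = 1} then P.rate₁ q.2.1
    else if q ∈ probedSet P f g then P.rate₂ (q.2.1 + q.2.2) else 0)
    * (if q ∈ probedSet P f g then 1 - P.τ else 1), ?_, fun n ω => ?_⟩
  · exact (Measurable.ite (measurableSet_firstLevel hf P 1) measurable_rate₁_inputs
      (Measurable.ite (measurableSet_probedSet hf hg P) measurable_rate₂_inputs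
        measurable_const)).mul
      (Measurable.ite (measurableSet_probedSet hf hg P) measurable_const measurable_const)
  · simp only [Strategy.roundReward, Strategy.rate, Strategy.dataTime, stationary_probes_iff]
    rfl

lemma exists_roundTime_eq : ∃ G : ℕ × ℂ × ℂ → ℝ, Measurable G ∧
    ∀ n ω, (X.stationary f hf g hg).roundTime n ω = G (X.inputs n ω) := by
  classical
  refine ⟨fun q => q.1 * P.τ + (if q ∈ {q : ℕ × ℂ × ℂ | f (P.rate₁ q.2.1) = 2} then P.τ else 0)
    + (if q ∈ transmitSet P f g then (if q ∈ probedSet P f g then 1 - P.τ else 1) else 0),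
    ?_, fun n ω => ?_⟩
  · exact (((measurable_from_nat.comp measurable_fst).mul_const _).add
      (Measurable.ite (measurableSet_firstLevel hf P 2) measurable_const measurable_const)).add
      (Measurable.ite (measurableSet_transmitSet hf hg P)
        (Measurable.ite (measurableSet_probedSet hf hg P) measurable_const measurable_const)
        measurable_const)
  · simp only [Strategy.roundTime, Strategy.dataTime, stationary_probes_iff,
      stationary_transmits_iff]
    rfl

variable [IsProbabilityMeasure μ]

lemma measureReal_notBefore_stationary (n : ℕ) :
    μ.real ((X.stationary f hf g hg).notBefore n)
      = (1 - μ.real {ω | X.inputs 0 ω ∈ transmitSet P f g}) ^ n := by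
  have hm := measurableSet_transmitSet hf hg P
  induction n with
  | zero =>
    have : (X.stationary f hf g hg).notBefore 0 = Set.univ := by
      ext ω; simp [Strategy.notBefore]
    simp [this]
  | succ n ih =>
    have h1 : (X.stationary f hf g hg).notBefore (n + 1)
        = (X.stationary f hf g hg).notBefore n ∩ X.inputs n ⁻¹' (transmitSet P f g)ᶜ := by
      ext ω
      simp only [Strategy.notBefore, Set.mem_ofPred_eq, Set.mem_inter_iff, Set.mem_preimage,
        Set.mem_compl_iff, ← stationary_transmits_iff hf hg]
      constructor
      · exact fun h => ⟨fun j hj => h j (by omega), h n (by omega)⟩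
      · intro h j hj
        rcases Nat.lt_succ_iff_lt_or_eq.1 hj with hj | rfl
        · exact h.1 j hj
        · exact h.2
    -- Applied to the indicator of not transmitting: each further round multiplies the survival
    -- probability by the same factor.
    have h2 := (X.stationary f hf g hg).setIntegral_notBefore n
      (g := (transmitSet P f g)ᶜ.indicator fun _ => 1) (measurable_const.indicator hm.compl)
    have h3 : ∀ n, (fun ω => (transmitSet P f g)ᶜ.indicator (fun _ => (1 : ℝ)) (X.inputs n ω))
        = (X.inputs n ⁻¹' (transmitSet P f g)ᶜ).indicator fun _ => 1 := fun n => by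
      funext ω; rfl
    rw [h3, h3, setIntegral_indicator (X.measurable_inputs n hm.compl),
      integral_indicator (X.measurable_inputs 0 hm.compl)] at h2
    simp only [integral_const, smul_eq_mul, mul_one, measureReal_restrict_apply MeasurableSet.univ,
      Set.univ_inter] at h2
    rw [h1, h2, ih, pow_succ, Set.preimage_compl,
      probReal_compl_eq_one_sub (X.measurable_inputs 0 hm)]
    rfl

/-- The throughput of a stationary strategy is determined by a single round. -/
lemma stationary_admissible_and_throughput
    (hpos : 0 < μ.real {ω | X.inputs 0 ω ∈ transmitSet P f g}) :
    (X.stationary f hf g hg).Admissible ∧ (X.stationary f hf g hg).throughput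
      = ENNReal.ofReal (∫ ω, (X.stationary f hf g hg).roundReward 0 ω ∂μ)
        / ENNReal.ofReal (∫ ω, (X.stationary f hf g hg).roundTime 0 ω ∂μ) := by
  set s := X.stationary f hf g hg with hs
  set π := μ.real {ω | X.inputs 0 ω ∈ transmitSet P f g} with hπ
  have hπ1 : π ≤ 1 := measureReal_le_one
  have hge : ∀ n, μ.real (s.notBefore n) = (1 - π) ^ n := measureReal_notBefore_stationary hf hg
  have hlt : 1 - π < 1 := by linarith
  have hnn : 0 ≤ 1 - π := by linarith
  have hae : ∀ᵐ ω ∂μ, ∃ n, s.Transmits n ω := by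
    rw [ae_iff]
    have h1 : ∀ n, μ {ω | ¬ ∃ n, s.Transmits n ω} ≤ ENNReal.ofReal ((1 - π) ^ n) := fun n => by
      rw [← hge n, ofReal_measureReal]
      refine measure_mono fun ω hω j _ hT => hω ⟨j, hT⟩
    have h2 := ENNReal.tendsto_ofReal (tendsto_pow_atTop_nhds_zero_of_lt_one hnn hlt)
    rw [ENNReal.ofReal_zero] at h2
    exact le_antisymm (ge_of_tendsto' h2 h1) zero_le
  obtain ⟨G, hG, hGr⟩ := exists_roundReward_eq (X := X) hf hg
  obtain ⟨H, hH, hHt⟩ := exists_roundTime_eq (X := X) hf hg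
  have hr : s.expectedReward = (∑' n, ENNReal.ofReal ((1 - π) ^ n))
      * ENNReal.ofReal (∫ ω, s.roundReward 0 ω ∂μ) := by
    rw [s.expectedReward_eq_tsum hae, ← ENNReal.tsum_mul_right]
    refine tsum_congr fun n => ?_
    simp only [hs, hGr]
    rw [← hs, s.setIntegral_notBefore n hG, hge, ENNReal.ofReal_mul (pow_nonneg hnn n)]
  have ht : s.expectedTime = (∑' n, ENNReal.ofReal ((1 - π) ^ n))
      * ENNReal.ofReal (∫ ω, s.roundTime 0 ω ∂μ) := by
    rw [s.expectedTime_eq_tsum hae, ← ENNReal.tsum_mul_right]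
    refine tsum_congr fun n => ?_
    simp only [hs, hHt]
    rw [← hs, s.setIntegral_notBefore n hH, hge, ENNReal.ofReal_mul (pow_nonneg hnn n)]
  have hS : ∑' n, ENNReal.ofReal ((1 - π) ^ n) = ENNReal.ofReal (1 - (1 - π))⁻¹ := by
    rw [← tsum_geometric_of_lt_one hnn hlt, ENNReal.ofReal_tsum_of_nonneg
      (fun n => pow_nonneg hnn n) (summable_geometric_of_lt_one hnn hlt)]
  -- The geometric series, the expected number of rounds, is common to reward and time; being
  -- nonzero and finite it cancels in `ENNReal`.
  have hS0 : ∑' n, ENNReal.ofReal ((1 - π) ^ n) ≠ 0 := by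
    rw [hS]
    exact (ENNReal.ofReal_pos.2 (inv_pos.2 (by linarith))).ne'
  have hS1 : ∑' n, ENNReal.ofReal ((1 - π) ^ n) ≠ ⊤ := by
    rw [hS]
    exact ENNReal.ofReal_ne_top
  refine ⟨⟨hae, ?_⟩, ?_⟩
  · rw [ht]
    exact ENNReal.mul_lt_top hS1.lt_top ENNReal.ofReal_lt_top
  · rw [Strategy.throughput, hr, ht, ENNReal.mul_div_mul_left _ _ hS0 hS1]

/-- Net gain of a stationary strategy at the price `θ`, given the first-level rate. -/
noncomputable def stationaryGain (P : Params) (f : ℝ → Fin 3) (θ u : ℝ) : ℝ :=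
  {u | f u = 1}.indicator (fun u => u - θ) u + {u | f u = 2}.indicator (fun u => P.J θ u 0) u

/-- Transmitting after a probing exactly when the outcome exceeds `θ` makes the per-round bound an
equality, so reward minus priced time is expected gain minus contention cost. -/
lemma integral_roundReward_stationary {θ : ℝ} (hθ : 0 ≤ θ)
    (hfg : ∀ x, f x = 2 → ∀ y, g y = true ↔ θ < y) :
    ∫ ω, (X.stationary f hf g hg).roundReward 0 ω ∂μ
      = θ * ∫ ω, (X.stationary f hf g hg).roundTime 0 ω ∂μ
        + (∫ u, stationaryGain P f θ u ∂P.F - θ * P.τ / P.ps) := by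
  set s := X.stationary f hf g hg with hs
  have h1 : ∀ ω, s.roundReward 0 ω - θ * s.roundTime 0 ω = s.netGain θ 0 ω := fun ω => by
    refine s.roundReward_sub_eq fun h => ?_
    have h2 := stationary_probes_iff (X := X) hf hg 0 ω
    rw [← hs, and_iff_right h] at h2
    rw [h2]
    exact (and_iff_right h).trans (hfg _ h _)
  have h2 := s.setIntegral_netGain hθ (n := 0) (A := Set.univ) MeasurableSet.univ
  simp only [Measure.restrict_univ] at h2
  have h3 : ∫ ω, s.meanNetGain θ 0 ω ∂μ = -(θ * P.τ / P.ps) + ∫ u, stationaryGain P f θ u ∂P.F := by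
    have hm : Measurable (stationaryGain P f θ) :=
      ((measurable_id.sub_const θ).indicator (hf (measurableSet_singleton 1))).add
        ((P.measurable_J_zero θ).indicator (hf (measurableSet_singleton 2)))
    have hi : Integrable (fun ω => s.meanNetGain θ 0 ω + θ * P.τ * X.K 0 ω) μ :=
      (s.integrable_meanNetGain hθ 0).add ((X.integrable_K 0).const_mul _)
    have he : ∀ ω, s.meanNetGain θ 0 ω
        = -(θ * P.τ * X.K 0 ω) + stationaryGain P f θ (X.R₁ 0 ω) := fun ω => rfl
    have hi' : Integrable (fun ω => stationaryGain P f θ (X.R₁ 0 ω)) μ := by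
      refine hi.congr (Filter.Eventually.of_forall fun ω => ?_)
      simp only [he]; ring
    simp only [he]
    rw [integral_add (Strategy.integrable_contention X θ 0) hi', Strategy.integral_contention,
      X.integral_comp_R₁ hm]
  rw [← sub_eq_iff_eq_add', ← integral_const_mul, ← integral_sub (s.integrable_roundReward 0)
    ((s.integrable_roundTime 0).const_mul θ)]
  simp only [h1]
  rw [h2, h3]
  ring

lemma transmit_prob_pos {a b : ℝ} (ha : 0 ≤ a) (hab : a < b) (h : ∀ u ∈ Set.Ioo a b, f u = 1) :
    0 < μ.real {ω | X.inputs 0 ω ∈ transmitSet P f g} := by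
  refine ENNReal.toReal_pos ?_ (measure_ne_top _ _)
  have h1 := P.F_Ioo_pos ha hab
  rw [← X.map_R₁ 0, Measure.map_apply (X.measurable_R₁ 0) measurableSet_Ioo] at h1
  exact (h1.trans_le (measure_mono fun ω hω => Or.inl (h _ hω))).ne'

/-- Verification: a rule realizing the pointwise maximum breaks even at the fair price, so its
one-round ratio is exactly `θ`, the universal upper bound. -/
lemma stationary_isOptimal {θ : ℝ} (hθ : 0 ≤ θ) (he : ∫ u, P.gain θ u ∂P.F = θ * P.τ / P.ps)
    (hfg : ∀ x, f x = 2 → ∀ y, g y = true ↔ θ < y)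
    (hgain : ∀ u, 0 ≤ u → stationaryGain P f θ u = P.gain θ u)
    (hpos : 0 < μ.real {ω | X.inputs 0 ω ∈ transmitSet P f g}) :
    (X.stationary f hf g hg).IsOptimal ∧ X.optimalThroughput = ENNReal.ofReal θ := by
  obtain ⟨h1, h2⟩ := stationary_admissible_and_throughput hf hg hpos
  have ht := (X.stationary f hf g hg).roundTime_integral_pos
  have h3 : ∫ u, stationaryGain P f θ u ∂P.F = θ * P.τ / P.ps := by
    rw [← he]
    exact integral_congr_ae (P.F_ae_nonneg.mono fun u hu => hgain u hu)
  rw [integral_roundReward_stationary hf hg hθ hfg, h3, sub_self, add_zero,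
    ← ENNReal.ofReal_div_of_pos ht, mul_div_assoc, div_self ht.ne', mul_one] at h2
  have h4 : X.optimalThroughput = ENNReal.ofReal θ :=
    le_antisymm (iSup₂_le fun s hs => s.throughput_le hθ he hs)
      (h2 ▸ le_iSup₂_of_le (X.stationary f hf g hg) h1 le_rfl)
  exact ⟨⟨h1, h2.trans h4.symm⟩, h4⟩

lemma stationary_throughput_lt {θ : ℝ} (hθ : 0 < θ)
    (hfg : ∀ x, f x = 2 → ∀ y, g y = true ↔ θ < y)
    (hlt : ∫ u, stationaryGain P f θ u ∂P.F < θ * P.τ / P.ps)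
    (hpos : 0 < μ.real {ω | X.inputs 0 ω ∈ transmitSet P f g}) :
    (X.stationary f hf g hg).throughput < ENNReal.ofReal θ := by
  obtain ⟨h1, h2⟩ := stationary_admissible_and_throughput hf hg hpos
  have ht := (X.stationary f hf g hg).roundTime_integral_pos
  rw [h2, integral_roundReward_stationary hf hg hθ.le hfg, ← ENNReal.ofReal_div_of_pos ht,
    ENNReal.ofReal_lt_ofReal_iff hθ, div_lt_iff₀ ht]
  linarith

end Stationary

end ProbingModel
end DOS

/-! ### Optimal throughput, and optimality or failure of the two strategies. -/

namespace DOS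
namespace ProbingModel

variable {P : Params} {Ω : Type*} [MeasurableSpace Ω] {μ : Measure Ω} [IsProbabilityMeasure μ]
  (X : ProbingModel P μ)

lemma stationaryGain_of_eq_zero {f : ℝ → Fin 3} {θ u : ℝ} (h : f u = 0) :
    stationaryGain P f θ u = 0 := by
  simp [stationaryGain, h]

lemma stationaryGain_of_eq_one {f : ℝ → Fin 3} {θ u : ℝ} (h : f u = 1) :
    stationaryGain P f θ u = u - θ := by
  simp [stationaryGain, h]

lemma stationaryGain_of_eq_two {f : ℝ → Fin 3} {θ u : ℝ} (h : f u = 2) :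
    stationaryGain P f θ u = P.J θ u 0 := by
  simp [stationaryGain, h]

lemma bool_ite_eq_true_iff {p : Prop} [Decidable p] : (if p then true else false) = true ↔ p := by
  simp

/-- The optimal throughput is the price that makes a round with optimal decisions fair. -/
lemma optimalThroughput_eq (hc : P.cr * (1 - P.τ) < 1) {θ : ℝ} (hθ : 0 ≤ θ)
    (he : ∫ u, P.gain θ u ∂P.F = θ * P.τ / P.ps) : X.optimalThroughput = ENNReal.ofReal θ := by
  have hm1 : MeasurableSet {u : ℝ | P.J θ u 0 ≤ u - θ ∧ 0 ≤ u - θ} :=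
    (measurableSet_le (P.measurable_J_zero θ) (measurable_id.sub_const θ)).inter
      (measurableSet_le measurable_const (measurable_id.sub_const θ))
  have hm2 : MeasurableSet {u : ℝ | 0 ≤ P.J θ u 0} :=
    measurableSet_le measurable_const (P.measurable_J_zero θ)
  classical
  let f : ℝ → Fin 3 := fun u => if P.J θ u 0 ≤ u - θ ∧ 0 ≤ u - θ then 1
    else if 0 ≤ P.J θ u 0 then 2 else 0
  have hf : Measurable f :=
    Measurable.ite hm1 measurable_const (Measurable.ite hm2 measurable_const measurable_const)
  have hg : Measurable (fun y : ℝ => if θ < y then true else false) :=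
    Measurable.ite measurableSet_Ioi measurable_const measurable_const
  -- Above `max xq θ` direct transmission is the maximizer, which guarantees a positive transmission
  -- probability.
  obtain ⟨xq, hxq, hq⟩ := Params.exists_J_zero_eq_sub hc hθ
  have h0 : (0 : ℝ) ≤ max xq θ := hxq.trans (le_max_left _ _)
  refine (stationary_isOptimal (X := X) hf hg hθ he (fun x _ y => bool_ite_eq_true_iff)
    (fun u hu => ?_) (transmit_prob_pos h0 (lt_add_one _) fun u hu => if_pos ?_)).2
  · by_cases h1 : P.J θ u 0 ≤ u - θ ∧ 0 ≤ u - θ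
    · rw [stationaryGain_of_eq_one (if_pos h1), Params.gain, max_eq_left h1.1, max_eq_left h1.2]
    · by_cases h2 : 0 ≤ P.J θ u 0
      · rw [stationaryGain_of_eq_two ((if_neg h1).trans (if_pos h2)), Params.gain,
          max_eq_right (a := u - θ), max_eq_left h2]
        by_contra h3
        exact h1 ⟨(not_le.1 h3).le, h2.trans (not_le.1 h3).le⟩
      · rw [stationaryGain_of_eq_zero ((if_neg h1).trans (if_neg h2)), Params.gain, max_eq_right]
        refine max_le ?_ (not_le.1 h2).le
        by_contra h3
        exact h1 ⟨(not_le.1 h2).le.trans (not_le.1 h3).le, (not_le.1 h3).le⟩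
  · have h1 := (le_max_left xq θ).trans_lt hu.1
    have h2 := (le_max_right xq θ).trans_lt hu.1
    have h3 := P.J_zero_sub_lt hc θ hxq h1
    constructor <;> linarith

variable {xJ xq θ θB : ℝ}

lemma ruleA_eq_zero {u : ℝ} (h : u < xJ) :
    (if u < xJ then 0 else if u ≤ xq then 2 else 1 : Fin 3) = 0 := if_pos h

lemma ruleA_eq_two {u : ℝ} (h1 : xJ ≤ u) (h2 : u ≤ xq) :
    (if u < xJ then 0 else if u ≤ xq then 2 else 1 : Fin 3) = 2 :=
  (if_neg (not_lt.2 h1)).trans (if_pos h2)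

lemma ruleA_eq_one {u : ℝ} (h1 : xJ ≤ u) (h2 : xq < u) :
    (if u < xJ then 0 else if u ≤ xq then 2 else 1 : Fin 3) = 1 :=
  (if_neg (not_lt.2 h1)).trans (if_neg (not_le.2 h2))

/-- With `xJ ≤ xq` the thresholds are the points where the maximizer in `gain` changes from giving
up to probing and from probing to transmitting. -/
lemma strategyA_isOptimal (h : P.SolvesA xJ xq θ) (hg : 0 ≤ P.J θ θ 0) :
    (X.strategyA xJ xq θ).IsOptimal := by
  have hle := h.le_iff.2 hg
  refine (stationary_isOptimal _ _ h.theta_pos.le (h.integral_gain hle)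
    (fun x _ y => bool_ite_eq_true_iff) (fun u hu => ?_)
    (transmit_prob_pos h.xq_nonneg (lt_add_one xq) fun u hu =>
      ruleA_eq_one (hle.trans hu.1.le) hu.1)).1
  have hq0 : 0 ≤ xq - θ := h.J_xq ▸ h.J_xJ.ge.trans (P.J_zero_monotone θ hle)
  have hprobe : u ≤ xq → u - θ ≤ P.J θ u 0 := fun h2 => by
    by_contra e
    have := (P.J_zero_sub_lt_iff h.cr_lt θ h.xq_nonneg hu).1 (by linarith [h.J_xq])
    linarith
  rcases lt_or_ge u xJ with h1 | h1
  · have h2 : P.J θ u 0 < 0 := (P.J_zero_lt θ hu h1).trans_eq h.J_xJ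
    have h3 := hprobe (h1.le.trans hle)
    rw [stationaryGain_of_eq_zero (ruleA_eq_zero h1), Params.gain,
      max_eq_right (max_le (by linarith) h2.le)]
  · rcases le_or_gt u xq with h2 | h2
    · have h3 : 0 ≤ P.J θ u 0 := h.J_xJ.ge.trans (P.J_zero_monotone θ h1)
      rw [stationaryGain_of_eq_two (ruleA_eq_two h1 h2), Params.gain, max_eq_right (hprobe h2),
        max_eq_left h3]
    · have h3 := P.J_zero_sub_lt h.cr_lt θ h.xq_nonneg h2
      have h4 := h.J_xq
      rw [stationaryGain_of_eq_one (ruleA_eq_one h1 h2), Params.gain,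
        max_eq_left (a := u - θ) (by linarith), max_eq_left (by linarith)]

lemma strategyB_isOptimal (hc : P.cr * (1 - P.τ) < 1) (hB : P.SolvesB θB)
    (hg : P.J θB θB 0 ≤ 0) :
    (X.strategyB θB).IsOptimal ∧ X.optimalThroughput = ENNReal.ofReal θB := by
  have hB0 := hB.nonneg
  refine stationary_isOptimal _ _ hB0
    ((Params.integral_gain_eq_directGain hc hB0 hg).trans hB)
    (fun x hx => absurd hx ?_) (fun u _ => ?_)
    (transmit_prob_pos hB0 (lt_add_one θB) fun u hu => if_pos hu.1)
  -- The rule never probes, so the condition on the second-level cutoff is vacuous.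
  · split_ifs <;> decide
  · rw [Params.gain_eq_directGain hc hB0 hg, Params.directGain]
    by_cases h1 : θB < u
    · rw [stationaryGain_of_eq_one (if_pos h1), max_eq_left (by linarith)]
    · rw [stationaryGain_of_eq_zero (if_neg h1), max_eq_right (by linarith)]

lemma solvesB_pos (hB : P.SolvesB θB) : 0 < θB := by
  refine hB.nonneg.lt_of_ne ?_
  rintro rfl
  have h1 : ∫ u, Params.directGain 0 u ∂P.F = 0 := by
    rw [Params.solvesB_iff.1 hB, zero_mul, zero_div]
  have h2 : 0 < ∫ u, Params.directGain 0 u ∂P.F := by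
    have h0 : 0 ≤ Params.directGain 0 := fun u => le_max_right _ _
    rw [integral_pos_iff_support_of_nonneg h0 (Params.integrable_directGain 0)]
    refine (P.F_Ioo_pos le_rfl one_pos).trans_le (measure_mono fun u hu => ?_)
    have : 0 < max (u - 0) 0 := lt_max_of_lt_left (by linarith [hu.1])
    exact this.ne'
  linarith

/-- In reversed order the rule never probes and transmits exactly from `xJ > θ ≥ θB` on. At the
optimal price `θB` it forgoes the positive gains on `(θB, xJ)`, an interval charged by `F`, so its
throughput is strictly smaller. -/
lemma strategyA_not_isOptimal (h : P.SolvesA xJ xq θ) (hg : P.J θ θ 0 < 0) (hB : P.SolvesB θB) :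
    ¬ (X.strategyA xJ xq θ).IsOptimal := by
  obtain ⟨hle, hgB⟩ := h.J_solvesB_nonpos hB hg
  have hr := Params.thresholds_of_neg h.cr_lt h.theta_pos.le h.J_xJ h.J_xq hg
  have hopt := (X.strategyB_isOptimal h.cr_lt hB hgB).2
  have hqJ := hr.2.trans hr.1
  have hrule : ∀ u : ℝ, xJ ≤ u →
      (if u < xJ then 0 else if u ≤ xq then 2 else 1 : Fin 3) = 1 := fun u hu =>
    ruleA_eq_one hu (hqJ.trans_le hu)
  have hgain : ∀ u, stationaryGain P
      (fun x => if x < xJ then 0 else if x ≤ xq then 2 else 1) θB u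
        = (Set.Ici xJ).indicator (fun u => u - θB) u := fun u => by
    rcases lt_or_ge u xJ with h1 | h1
    · rw [stationaryGain_of_eq_zero (ruleA_eq_zero h1),
        Set.indicator_of_notMem (by simpa using h1)]
    · rw [stationaryGain_of_eq_one (hrule u h1), Set.indicator_of_mem (Set.mem_Ici.2 h1)]
  have hint : Integrable ((Set.Ici xJ).indicator (fun u : ℝ => u - θB)) P.F :=
    (P.integrable_id_F.sub (integrable_const θB)).indicator measurableSet_Ici
  have hlt : ∫ u, stationaryGain P
      (fun x => if x < xJ then 0 else if x ≤ xq then 2 else 1) θB u ∂P.F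
        < θB * P.τ / P.ps := by
    simp only [hgain]
    rw [← hB, ← sub_pos]
    change 0 < ∫ u, Params.directGain θB u ∂P.F - _
    have hdiff : 0 ≤ fun u => Params.directGain θB u
        - (Set.Ici xJ).indicator (fun u => u - θB) u := fun u => by
      simp only [Pi.zero_apply, sub_nonneg]
      rw [Set.indicator_apply]
      split_ifs
      · exact le_max_left _ _
      · exact le_max_right _ _
    rw [← integral_sub (Params.integrable_directGain θB) hint,
      integral_pos_iff_support_of_nonneg hdiff ((Params.integrable_directGain θB).sub hint)]
    refine (P.F_Ioo_pos hB.nonneg (hle.trans_lt hr.1)).trans_le (measure_mono fun u hu => ?_)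
    rw [Function.mem_support, Set.indicator_of_notMem (by simpa using hu.2), sub_zero,
      Params.directGain, max_eq_left (by linarith [hu.1])]
    linarith [hu.1]
  have hthr : (X.strategyA xJ xq θ).throughput < ENNReal.ofReal θB := by
    refine stationary_throughput_lt _ _ (solvesB_pos hB) (fun x hx => ?_) hlt
      (transmit_prob_pos h.xJ_nonneg (lt_add_one xJ) fun u hu => hrule u hu.1.le)
    rcases lt_or_ge x xJ with h1 | h1
    · rw [ruleA_eq_zero h1] at hx
      exact absurd hx (by decide)
    · rw [hrule x h1] at hx
      exact absurd hx (by decide)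
  intro hA
  rw [hA.2, hopt] at hthr
  exact lt_irrefl _ hthr

end ProbingModel
end DOS

theorem theorem2 (P : DOS.Params) {Ω : Type*} [MeasurableSpace Ω] (μ : Measure Ω)
    [IsProbabilityMeasure μ] (X : DOS.ProbingModel P μ) :
    (P.cr < 1 / (1 - P.τ) →
      P.Re / X.optimalThroughput.toReal * Real.exp (-(X.optimalThroughput.toReal / P.Re))
        < P.τ / (1 - P.τ) →
      ∃! t : ℝ × ℝ × ℝ, P.SolvesA t.1 t.2.1 t.2.2) ∧
    (∃! θB : ℝ, P.SolvesB θB) ∧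
    ∀ xJ xq θA θB : ℝ, P.SolvesA xJ xq θA → P.SolvesB θB →
      (xJ ≤ xq ↔ 0 ≤ P.J θA θA 0) ∧
      ((X.strategyA xJ xq θA).IsOptimal ↔ 0 ≤ P.J θA θA 0) ∧
      (¬ 0 ≤ P.J θA θA 0 → (X.strategyB θB).IsOptimal) := by
  refine ⟨fun hc hθ => ?_, P.existsUnique_solvesB, fun xJ xq θA θB hA hB =>
    ⟨hA.le_iff, ⟨fun h => ?_, fun h => X.strategyA_isOptimal hA h⟩, fun h => ?_⟩⟩
  · rw [lt_div_iff₀ P.one_sub_tau_pos] at hc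
    obtain ⟨θ, h0, he⟩ := DOS.Params.exists_integral_gain_eq P
    -- Multiplied by `θ*`, the hypothesis becomes `J_θ(0, 0) < 0` at `θ = θ*`, the condition under
    -- which a nonnegative `x_J` exists.
    rw [X.optimalThroughput_eq hc h0.le he, ENNReal.toReal_ofReal h0.le, div_mul_eq_mul_div,
      ← P.excess_at_zero h0.le, div_lt_iff₀ h0] at hθ
    obtain ⟨xJ, xq, θA, hA⟩ := DOS.Params.exists_solvesA hc h0.le he
      (hθ.le.trans_eq (by rw [div_mul_eq_mul_div, mul_comm]))
    refine ⟨(xJ, xq, θA), hA, fun t ht => ?_⟩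
    obtain ⟨h1, h2, h3⟩ := ht.unique hA
    exact Prod.ext h1 (Prod.ext h2 h3)
  · by_contra hg
    exact X.strategyA_not_isOptimal hA (not_le.1 hg) hB h
  · exact (X.strategyB_isOptimal hA.cr_lt hB (hA.J_solvesB_nonpos hB (not_le.1 h)).2).1
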